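/- Let $E=(E^0,E^1,r,s)$ be a finite directed graph without sources (every vertex is the range of an edge), let $G$ be a discrete group acting on $E$ by graph automorphisms, and let $\varphi:G\times E^1\to G$ be a one-cocycle, $\varphi(gh,a)=\varphi(g,ha)\varphi(h,a)$, with $\varphi(g,a)\cdot v=g\cdot v$ for all $g\in G$, $a\in E^1$, $v\in E^0$. Finite paths $\alpha=a_1\cdots a_n$ and infinite paths $\xi=a_1a_2\cdots$ satisfy $s(a_i)=r(a_{i+1})$; vertices are the finite paths of length $0$; $d(\alpha)$ and $|\alpha|$ are the source and the length of $\alpha\in E^*$, and $\xi|_n$ is the initial segment of length $n$ of $\xi\in E^\infty$. The action and $\varphi$ are extended to paths by $g(a\alpha)=(ga)(\varphi(g,a)\alpha)$, $\varphi(g,v)=g$ for $v\in E^0$ and $\varphi(g,a\alpha)=\varphi(\varphi(g,a),\alpha)$. Let $\mathcal S_{G,E}=\{(\alpha,g,\beta):\alpha,\beta\in E^*,\ g\in G,\ d(\alpha)=g\,d(\beta)\}\cup\{0\}$, with $$(\alpha,g,\beta)(\gamma,h,\delta)=\begin{cases}(\alpha,\,g\varphi(h^{-1},\varepsilon)^{-1},\,\delta(h^{-1}\varepsilon))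 & \beta=\gamma\varepsilon,\\ (\alpha(g\varepsilon),\,\varphi(g,\varepsilon)h,\,\delta)&\gamma=\beta\varepsilon,\\ 0&\text{otherwise,}\end{cases}\qquad(\alpha,g,\beta)^*=(\beta,g^{-1},\alpha),$$ acting on $E^\infty$ by $(\alpha,g,\beta)\cdot\beta\xi=\alpha(g\xi)$. Let $\mathcal G=\mathcal G_{(G,E)}$ be its groupoid of germs $[\alpha,g,\beta;\beta\xi]$, where $[x;\eta]=[y;\mu]$ iff $\eta=\mu$ and $xe=ye$ for some idempotent $e\neq0$ of $\mathcal S_{G,E}$ with $e\cdot\eta=\eta$, and where $[x;y\eta][y;\eta]=[xy;\eta]$ and $[x;\eta]^{-1}=[x^*;x\eta]$. Its topology is generated by the sets $\{[\alpha,g,\beta;\zeta]:\zeta\in Z(\delta)\}$, $(\alpha,g,\beta)\in\mathcal S_{G,E}$, $\delta\in E^*$, where $Z(\delta)=\{\delta\eta : \eta\in E^\infty\}$. Write $\mathcal G^{(0)}$ for the unit space. Let $\breve G=G^{\mathbb N}/G^{(\mathbb N)}$ be the group of sequences in $G$ modulo those with finitely many entries $\ne1$, let $\breve\rho$ be its automorphism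 induced by the right shift, and let $\ell:\mathcal G\to\breve G\rtimes_{\breve\rho}\mathbb Z$ be the lag cocycle $$\ell([\alpha,g,\beta;\beta\xi])=\big(\breve\rho^{|\alpha|}\big([\varphi(g,\xi|_n)]_{n\ge0}\big),\ |\alpha|-|\beta|\big).$$ A groupoid $\mathcal H$ is principal if its isotropy bundle $\operatorname{Iso}(\mathcal H)=\{\gamma:r(\gamma)=s(\gamma)\}$ equals $\mathcal H^{(0)}$. A topological groupoid $\mathcal H$ is effective if the interior of $\operatorname{Iso}(\mathcal H)$ is $\mathcal H^{(0)}$, and strongly effective if $\mathcal H|_C=\{\gamma: r(\gamma)\in C\}$ is effective for every closed $C\subseteq\mathcal H^{(0)}$ that is invariant ($r(\gamma)\in C\iff s(\gamma)\in C$). Suppose that $\mathcal G$ is Hausdorff, and let $e$ be the identity of $\breve G\rtimes_{\breve\rho}\mathbb Z$. Then: 1. $\ell^{-1}(e)=\{[\alpha,1,\beta;\beta\xi] : \alpha,\beta\in E^*,\ d(\alpha)=d(\beta)=r(\xi),\ |\alpha|=|\beta|\}$. 2. $\ell^{-1}(e)$ is principal. 3. $\mathcal G$ is ample (étale, Hausdorff,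 with locally compact zero-dimensional unit space), and $\ell^{-1}(e)$ is strongly effective. 4. Consequently, if $\ell$ is locally constant, then for every field $K$ the Steinberg algebra $A_K(\mathcal G)$ (locally constant compactly supported functions $\mathcal G\to K$ with convolution) is graded by $\breve G\rtimes_{\breve\rho}\mathbb Z$, with homogeneous subspaces $A_g=\{f\in A_K(\mathcal G): f=0 \text{ outside } \ell^{-1}(g)\}$, and $U\mapsto A_K(\mathcal G|_U)$ is an isomorphism from the lattice of open invariant subsets of $\mathcal G^{(0)}$ onto the lattice of graded ideals of $A_K(\mathcal G)$, that is, of the two-sided ideals $J$ with $J=\bigoplus_g (J\cap A_g)$. -/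

import Mathlib

open Topology

/-! ### Groupoids, ample groupoids, cocycles -/

/-- A (small) groupoid, given by its set of arrows `𝒢`.  The objects are identified with the
identity arrows, so that the range map `r` and the source map `s` take values in `𝒢`.
The product `mul γ δ` has a meaning only for composable pairs, i.e. when `s γ = r δ`. -/
class ArrowGroupoid (𝒢 : Type*) where
  r : 𝒢 → 𝒢
  s : 𝒢 → 𝒢
  mul : 𝒢 → 𝒢 → 𝒢
  inv : 𝒢 → 𝒢
  s_r : ∀ γ, s (r γ) = r γ
  r_s : ∀ γ, r (s γ) = s γ
  r_mul : ∀ γ δ, s γ = r δ → r (mul γ δ) = r γ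
  s_mul : ∀ γ δ, s γ = r δ → s (mul γ δ) = s δ
  mul_assoc : ∀ γ δ ε, s γ = r δ → s δ = r ε → mul (mul γ δ) ε = mul γ (mul δ ε)
  r_mul_self : ∀ γ, mul (r γ) γ = γ
  mul_s_self : ∀ γ, mul γ (s γ) = γ
  r_inv : ∀ γ, r (inv γ) = s γ
  s_inv : ∀ γ, s (inv γ) = r γ
  mul_inv : ∀ γ, mul γ (inv γ) = r γ
  inv_mul : ∀ γ, mul (inv γ) γ = s γ

namespace ArrowGroupoid

section Basic

variable (𝒢 : Type*) [ArrowGroupoid 𝒢]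

/-- The unit space, as a set of arrows. -/
def units : Set 𝒢 := {u | r u = u}

/-- The isotropy bundle. -/
def isotropy : Set 𝒢 := {γ | r γ = s γ}

variable {𝒢}

theorem r_r (γ : 𝒢) : r (r γ) = r γ := by
  have h := r_s (r γ)
  rwa [s_r] at h

theorem s_s (γ : 𝒢) : s (s γ) = s γ := by
  have h := s_r (s γ)
  rwa [r_s] at h

/-- The range map, with values in the unit space. -/
def rng (γ : 𝒢) : units 𝒢 := ⟨r γ, r_r γ⟩

/-- The source map, with values in the unit space. -/
def src (γ : 𝒢) : units 𝒢 := ⟨s γ, r_s γ⟩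

/-- Invariant subsets of the unit space. -/
def IsInvariant (U : Set (units 𝒢)) : Prop := ∀ γ : 𝒢, rng γ ∈ U ↔ src γ ∈ U

variable (𝒢)

/-- `𝒢` is principal if its isotropy bundle is its unit space. -/
def IsPrincipal : Prop := isotropy 𝒢 = units 𝒢

/-- A topological groupoid that is étale, Hausdorff and has a zero-dimensional unit space. -/
structure IsAmple [TopologicalSpace 𝒢] : Prop where
  continuous_inv : Continuous (inv : 𝒢 → 𝒢)
  continuous_mul : Continuous fun p : {p : 𝒢 × 𝒢 // s p.1 = r p.2} => mul p.1.1 p.1.2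
  hausdorff : T2Space 𝒢
  locallyCompact_units : LocallyCompactSpace (units 𝒢)
  isLocalHomeomorph_rng : IsLocalHomeomorph (rng : 𝒢 → units 𝒢)
  zeroDimensional_units : TopologicalSpace.IsTopologicalBasis {U : Set (units 𝒢) | IsClopen U}

/-- `𝒢` is effective if the interior of its isotropy bundle is its unit space. -/
def IsEffective [TopologicalSpace 𝒢] : Prop := interior (isotropy 𝒢) = units 𝒢

/-- A subgroupoid of `𝒢`. -/
structure Sub where
  carrier : Set 𝒢
  r_mem : ∀ γ ∈ carrier, r γ ∈ carrier
  s_mem : ∀ γ ∈ carrier, s γ ∈ carrier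
  mul_mem : ∀ γ ∈ carrier, ∀ δ ∈ carrier, s γ = r δ → mul γ δ ∈ carrier
  inv_mem : ∀ γ ∈ carrier, inv γ ∈ carrier

variable {𝒢}

open scoped Classical in
/-- A subgroupoid is a groupoid, with the operations of `𝒢`. -/
noncomputable instance (H : Sub 𝒢) : ArrowGroupoid H.carrier where
  r γ := ⟨r γ.1, H.r_mem _ γ.2⟩
  s γ := ⟨s γ.1, H.s_mem _ γ.2⟩
  mul γ δ := if h : s γ.1 = r δ.1 then ⟨mul γ.1 δ.1, H.mul_mem _ γ.2 _ δ.2 h⟩ else γ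
  inv γ := ⟨inv γ.1, H.inv_mem _ γ.2⟩
  s_r γ := Subtype.ext (s_r γ.1)
  r_s γ := Subtype.ext (r_s γ.1)
  r_mul γ δ h := by
    have h' : s γ.1 = r δ.1 := congrArg Subtype.val h
    simp only [dif_pos h']
    exact Subtype.ext (r_mul _ _ h')
  s_mul γ δ h := by
    have h' : s γ.1 = r δ.1 := congrArg Subtype.val h
    simp only [dif_pos h']
    exact Subtype.ext (s_mul _ _ h')
  mul_assoc γ δ ε h k := by
    have h' : s γ.1 = r δ.1 := congrArg Subtype.val h
    have k' : s δ.1 = r ε.1 := congrArg Subtype.val k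
    have h1 : s (mul γ.1 δ.1) = r ε.1 := (s_mul _ _ h').trans k'
    have h2 : s γ.1 = r (mul δ.1 ε.1) := h'.trans (r_mul _ _ k').symm
    simp only [dif_pos h', dif_pos k', dif_pos h1, dif_pos h2]
    exact Subtype.ext (mul_assoc _ _ _ h' k')
  r_mul_self γ := by
    simp only [dif_pos (s_r γ.1)]
    exact Subtype.ext (r_mul_self _)
  mul_s_self γ := by
    simp only [dif_pos (r_s γ.1).symm]
    exact Subtype.ext (mul_s_self _)
  r_inv γ := Subtype.ext (r_inv γ.1)
  s_inv γ := Subtype.ext (s_inv γ.1)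
  mul_inv γ := by
    simp only [dif_pos (r_inv γ.1).symm]
    exact Subtype.ext (mul_inv _)
  inv_mul γ := by
    simp only [dif_pos (s_inv γ.1)]
    exact Subtype.ext (inv_mul _)

/-- The restriction `𝒢|_U` of `𝒢` to an invariant set of units. -/
def restrict (U : Set (units 𝒢)) (hU : IsInvariant U) : Sub 𝒢 where
  carrier := {γ | rng γ ∈ U}
  r_mem γ h := by
    have : rng (r γ) = rng γ := Subtype.ext (r_r γ)
    simpa only [Set.mem_ofPred_eq, this] using h
  s_mem γ h := by
    have : rng (s γ) = src γ := Subtype.ext (r_s γ)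
    simpa only [Set.mem_ofPred_eq, this] using (hU γ).1 h
  mul_mem γ h δ _ hc := by
    have : rng (mul γ δ) = rng γ := Subtype.ext (r_mul _ _ hc)
    simpa only [Set.mem_ofPred_eq, this] using h
  inv_mem γ h := by
    have : rng (inv γ) = src γ := Subtype.ext (r_inv γ)
    simpa only [Set.mem_ofPred_eq, this] using (hU γ).1 h

variable (𝒢) in
/-- `𝒢` is strongly effective if `𝒢|_C` (with the relative topology) is effective for every
closed invariant set `C` of units. -/
def IsStronglyEffective [TopologicalSpace 𝒢] : Prop :=
  ∀ (C : Set (units 𝒢)) (hC : IsInvariant C), IsClosed C → IsEffective (restrict C hC).carrier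

variable (𝒢) in
/-- A cocycle on `𝒢` with values in the group `Γ`. -/
structure Cocycle (Γ : Type*) [Group Γ] where
  toFun : 𝒢 → Γ
  map_mul : ∀ γ δ, s γ = r δ → toFun (mul γ δ) = toFun γ * toFun δ

namespace Cocycle

variable {Γ : Type*} [Group Γ] (c : Cocycle 𝒢 Γ)

instance : CoeFun (Cocycle 𝒢 Γ) fun _ => 𝒢 → Γ := ⟨toFun⟩

theorem map_r (γ : 𝒢) : c (r γ) = 1 := by
  have h := c.map_mul (r γ) γ (s_r γ)
  rw [r_mul_self] at h
  exact right_eq_mul.1 h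

theorem map_s (γ : 𝒢) : c (s γ) = 1 := by rw [← r_inv, map_r]

theorem map_inv (γ : 𝒢) : c (inv γ) = (c γ)⁻¹ := by
  have h := c.map_mul (inv γ) γ (s_inv γ)
  rw [inv_mul, map_s] at h
  exact eq_inv_of_mul_eq_one_left h.symm

/-- The subgroupoid `c⁻¹(e)`, where `e` is the identity of `Γ`. -/
def ker : Sub 𝒢 where
  carrier := {γ | c γ = 1}
  r_mem γ _ := c.map_r γ
  s_mem γ _ := c.map_s γ
  mul_mem γ h δ k hc := by
    simp only [Set.mem_ofPred_eq] at h k ⊢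
    rw [c.map_mul _ _ hc, h, k, one_mul]
  inv_mem γ h := by
    simp only [Set.mem_ofPred_eq] at h ⊢
    rw [c.map_inv, h, inv_one]

end Cocycle

end Basic

/-! ### Steinberg algebras, gradings, graded ideals -/

section Steinberg

variable (K : Type*) [Field K] (𝒢 : Type*) [TopologicalSpace 𝒢]

/-- The Steinberg algebra `A_K(𝒢)` of a Hausdorff ample groupoid, as a vector space:
locally constant functions with compact support. -/
def steinberg : Submodule K (𝒢 → K) where
  carrier := {f | IsLocallyConstant f ∧ IsCompact (Function.support f)}
  zero_mem' := ⟨IsLocallyConstant.const 0, by simp⟩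
  add_mem' := by
    rintro f g ⟨hf, hf'⟩ ⟨hg, hg'⟩
    refine ⟨hf.add hg, (hf'.union hg').of_isClosed_subset ?_ (Function.support_add f g)⟩
    exact ((hf.add hg).isClopen_fiber 0).compl.isClosed
  smul_mem' := by
    rintro a f ⟨hf, hf'⟩
    have h : IsLocallyConstant (a • f) := hf.comp (a • ·)
    refine ⟨h, hf'.of_isClosed_subset (h.isClopen_fiber 0).compl.isClosed ?_⟩
    exact Function.support_const_smul_subset a f

/-- For `W ⊆ 𝒢` open, the subspace `C_c(W, K)` of `A_K(𝒢)`, functions on `W` being extended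
by zero; if `W` is an open subgroupoid then this is `A_K(W)`. -/
def steinbergOn (W : Set 𝒢) : Submodule K (𝒢 → K) where
  carrier := {f | f ∈ steinberg K 𝒢 ∧ ∀ γ ∉ W, f γ = 0}
  zero_mem' := ⟨zero_mem _, fun _ _ => rfl⟩
  add_mem' := by
    rintro f g ⟨hf, hf'⟩ ⟨hg, hg'⟩
    exact ⟨add_mem hf hg, fun γ h => by simp [hf' γ h, hg' γ h]⟩
  smul_mem' := by
    rintro a f ⟨hf, hf'⟩
    exact ⟨Submodule.smul_mem _ a hf, fun γ h => by simp [hf' γ h]⟩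

variable {K 𝒢} [ArrowGroupoid 𝒢]

/-- The convolution product.  For `f`, `g` in the Steinberg algebra of a Hausdorff ample groupoid
the sum has only finitely many nonzero terms. -/
noncomputable def conv (f g : 𝒢 → K) (γ : 𝒢) : K :=
  ∑ᶠ p : {p : 𝒢 × 𝒢 // s p.1 = r p.2 ∧ mul p.1 p.2 = γ}, f p.1.1 * g p.1.2

/-- Two-sided ideals of the Steinberg algebra. -/
structure IsIdeal (J : Submodule K (𝒢 → K)) : Prop where
  le : J ≤ steinberg K 𝒢
  conv_mem_left : ∀ f ∈ steinberg K 𝒢, ∀ g ∈ J, conv f g ∈ J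
  conv_mem_right : ∀ f ∈ steinberg K 𝒢, ∀ g ∈ J, conv g f ∈ J

variable {Γ : Type*} [Group Γ]

variable (K) in
/-- The homogeneous subspace `A_g = C_c(c⁻¹(g), K)` of `A_K(𝒢)`. -/
def homogeneous (c : Cocycle 𝒢 Γ) (g : Γ) : Submodule K (𝒢 → K) :=
  steinbergOn K 𝒢 {γ | c γ = g}

variable (K) in
/-- `A_K(𝒢)` is the direct sum of the subspaces `A_g`, and `A_g A_h ⊆ A_{gh}`. -/
structure IsGrading (A : Γ → Submodule K (𝒢 → K)) : Prop where
  independent : iSupIndep A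
  iSup_eq : ⨆ g, A g = steinberg K 𝒢
  conv_mem : ∀ g h, ∀ f ∈ A g, ∀ f' ∈ A h, conv f f' ∈ A (g * h)

/-- Graded ideals: two-sided ideals `J` that are the (automatically direct) sum of the
subspaces `J ∩ A_g`. -/
def IsGradedIdeal (A : Γ → Submodule K (𝒢 → K)) (J : Submodule K (𝒢 → K)) : Prop :=
  IsIdeal J ∧ J = ⨆ g, J ⊓ A g

end Steinberg

end ArrowGroupoid

/-! ### The lag group -/

section LagGroup

variable (G : Type*) [Group G]

/-- The sequences in `G` with only finitely many entries different from `1`. -/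
def finSeq : Subgroup (ℕ → G) where
  carrier := {x | (Function.mulSupport x).Finite}
  one_mem' := by simp
  mul_mem' hx hy := (hx.union hy).subset (Function.mulSupport_mul _ _)
  inv_mem' hx := by simpa using hx

instance finSeq_normal : (finSeq G).Normal where
  conj_mem x hx y := by
    refine Set.Finite.subset (s := Function.mulSupport x) hx ?_
    intro n hn h
    simp only [Function.mem_mulSupport, ne_eq, Pi.mul_apply, Pi.inv_apply] at hn h
    simp [h] at hn

/-- The corona group `G^∞ / G^(∞)`. -/
abbrev Corona : Type _ := (ℕ → G) ⧸ finSeq G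

variable {G}

theorem Corona.mk_eq_mk {x y : ℕ → G} :
    (QuotientGroup.mk x : Corona G) = QuotientGroup.mk y ↔ ∃ N, ∀ n ≥ N, x n = y n := by
  rw [QuotientGroup.eq]
  constructor
  · intro h
    obtain ⟨N, hN⟩ := Set.Finite.bddAbove (s := Function.mulSupport (x⁻¹ * y)) h
    refine ⟨N + 1, fun n hn => ?_⟩
    by_contra hne
    have : n ∈ Function.mulSupport (x⁻¹ * y) := by
      simp only [Function.mem_mulSupport, Pi.mul_apply, Pi.inv_apply, ne_eq]
      intro h1
      exact hne (inv_mul_eq_one.1 h1)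
    have := hN this
    omega
  · rintro ⟨N, hN⟩
    refine Set.Finite.subset (Set.finite_lt_nat N) ?_
    intro n hn
    by_contra hlt
    apply hn
    simp [hN n (not_lt.1 hlt)]

/-- The right shift on sequences. -/
def rshift : (ℕ → G) →* (ℕ → G) where
  toFun x n := if n = 0 then 1 else x (n - 1)
  map_one' := by ext n; simp
  map_mul' x y := by ext n; by_cases h : n = 0 <;> simp [h]

/-- The left shift on sequences. -/
def lshift : (ℕ → G) →* (ℕ → G) where
  toFun x n := x (n + 1)
  map_one' := rfl
  map_mul' _ _ := rfl

theorem mk_rshift_congr (x : ℕ → G) (hx : x ∈ finSeq G) : rshift x ∈ finSeq G := by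
  have h : (QuotientGroup.mk 1 : Corona G) = QuotientGroup.mk x :=
    QuotientGroup.eq.2 (by simpa using hx)
  obtain ⟨N, hN⟩ := Corona.mk_eq_mk.1 h
  have h' : (QuotientGroup.mk 1 : Corona G) = QuotientGroup.mk (rshift x) := by
    refine Corona.mk_eq_mk.2 ⟨N + 1, fun n hn => ?_⟩
    have h0 : n ≠ 0 := by omega
    simp only [rshift, MonoidHom.coe_mk, OneHom.coe_mk, h0, if_false]
    exact hN (n - 1) (by omega)
  simpa using QuotientGroup.eq.1 h'

theorem mk_lshift_congr (x : ℕ → G) (hx : x ∈ finSeq G) : lshift x ∈ finSeq G := by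
  have h : (QuotientGroup.mk 1 : Corona G) = QuotientGroup.mk x :=
    QuotientGroup.eq.2 (by simpa using hx)
  obtain ⟨N, hN⟩ := Corona.mk_eq_mk.1 h
  have h' : (QuotientGroup.mk 1 : Corona G) = QuotientGroup.mk (lshift x) :=
    Corona.mk_eq_mk.2 ⟨N, fun n hn => hN (n + 1) (by omega)⟩
  simpa using QuotientGroup.eq.1 h'

variable (G) in
/-- The automorphism of the corona group induced by the right shift; its inverse is induced by
the left shift. -/
def coronaShift : MulAut (Corona G) where
  toFun := QuotientGroup.map (finSeq G) (finSeq G) rshift mk_rshift_congr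
  invFun := QuotientGroup.map (finSeq G) (finSeq G) lshift mk_lshift_congr
  left_inv x := by
    induction x using QuotientGroup.induction_on with
    | H x => rfl
  right_inv x := by
    induction x using QuotientGroup.induction_on with
    | H x =>
      refine Corona.mk_eq_mk.2 ⟨1, fun n hn => ?_⟩
      have h0 : n ≠ 0 := by omega
      simp only [rshift, lshift, MonoidHom.coe_mk, OneHom.coe_mk, h0, if_false]
      congr 1
      omega
  map_mul' := map_mul _

variable (G) in
/-- The action of `ℤ` on the corona group by powers of the shift. -/
def coronaAction : Multiplicative ℤ →* MulAut (Corona G) := zpowersHom _ (coronaShift G)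

theorem coronaAction_neg (m : ℕ) (x : ℕ → G) :
    coronaAction G (Multiplicative.ofAdd (-(m : ℤ))) (QuotientGroup.mk x : Corona G) =
      QuotientGroup.mk fun n => x (m + n) := by
  induction m generalizing x with
  | zero => simp
  | succ m ih =>
    have e : (Multiplicative.ofAdd (-((m + 1 : ℕ) : ℤ))) =
        Multiplicative.ofAdd (-(m : ℤ)) * Multiplicative.ofAdd (-1 : ℤ) := by
      rw [← ofAdd_add]
      congr 1
      push_cast
      ring
    have e1 : coronaAction G (Multiplicative.ofAdd (-1 : ℤ)) (QuotientGroup.mk x : Corona G) =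
        QuotientGroup.mk (lshift x) := by
      change ((coronaShift G) ^ (-1 : ℤ)) _ = _
      rw [zpow_neg_one]
      rfl
    rw [e, map_mul, MulAut.mul_apply, e1, ih]
    congr 1
    funext n
    change x (m + n + 1) = x (m + 1 + n)
    congr 1
    omega

theorem coronaAction_eq_iff (a b : ℕ) (x y : ℕ → G) :
    coronaAction G (Multiplicative.ofAdd (a : ℤ)) (QuotientGroup.mk x : Corona G) =
      coronaAction G (Multiplicative.ofAdd (b : ℤ)) (QuotientGroup.mk y : Corona G) ↔
    ∃ N, ∀ n ≥ N, x (b + n) = y (a + n) := by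
  have key : ∀ (c d : ℤ) (z : Corona G),
      coronaAction G (Multiplicative.ofAdd c) (coronaAction G (Multiplicative.ofAdd d) z) =
        coronaAction G (Multiplicative.ofAdd (c + d)) z := by
    intro c d z
    rw [ofAdd_add, map_mul, MulAut.mul_apply]
  have e1 : -(a + b : ℤ) + a = -b := by ring
  have e2 : -(a + b : ℤ) + b = -a := by ring
  rw [← Corona.mk_eq_mk (x := fun n => x (b + n)), ← coronaAction_neg, ← coronaAction_neg,
    ← (coronaAction G (Multiplicative.ofAdd (-(a + b : ℤ)))).injective.eq_iff, key, key, e1, e2]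

variable (G) in
/-- The lag group: the semidirect product of the corona group by `ℤ`. -/
abbrev LagGroup : Type _ := Corona G ⋊[coronaAction G] Multiplicative ℤ

end LagGroup

/-! ### Groups acting on graphs -/

/-- The basic data: a directed graph with vertex set `V` and edge set `E`, without sources
(every vertex is the range of some edge), on which `G` acts by graph automorphisms, and a
one-cocycle `φ : G × E → G` with `φ(g, a) • v = g • v`. -/
structure GraphTriple (G V E : Type*) [Group G] [MulAction G V] [MulAction G E] where
  r : E → V
  s : E → V
  r_smul : ∀ (g : G) (a : E), r (g • a) = g • r a
  s_smul : ∀ (g : G) (a : E), s (g • a) = g • s a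
  φ : G → E → G
  φ_mul : ∀ (g h : G) (a : E), φ (g * h) a = φ g (h • a) * φ h a
  φ_smul : ∀ (g : G) (a : E) (v : V), φ g a • v = g • v
  no_sources : ∀ v : V, ∃ a : E, r a = v

namespace GraphTriple

section

variable {G V E : Type*} [Group G] [MulAction G V] [MulAction G E] (T : GraphTriple G V E)

/-- `a₁ a₂ ⋯ aₙ` is a path with range `v`, i.e. `r a₁ = v` and `s aᵢ = r aᵢ₊₁`. -/
def IsPath : V → List E → Prop
  | _, [] => True
  | v, a :: l => T.r a = v ∧ IsPath (T.s a) l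

/-- The source `d(α)` of the path `α` with range `v` and the given list of edges. -/
def endpoint : V → List E → V
  | v, [] => v
  | _, a :: l => endpoint (T.s a) l

/-- The action of `G` on finite paths: `g (a α) = (g a) (φ(g, a) α)`. -/
def actList : G → List E → List E
  | _, [] => []
  | g, a :: l => g • a :: actList (T.φ g a) l

/-- The extension of `φ` to finite paths: `φ(g, v) = g` for paths `v` of length zero,
and `φ(g, a α) = φ(φ(g, a), α)`. -/
def cocList : G → List E → G
  | g, [] => g
  | g, a :: l => cocList (T.φ g a) l

theorem cocList_append (g : G) (l m : List E) :
    T.cocList g (l ++ m) = T.cocList (T.cocList g l) m := by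
  induction l generalizing g with
  | nil => rfl
  | cons a l ih => exact ih _

theorem cocList_smul (g : G) (l : List E) (v : V) : T.cocList g l • v = g • v := by
  induction l generalizing g with
  | nil => rfl
  | cons a l ih => exact (ih _).trans (T.φ_smul g a v)

theorem length_actList (g : G) (l : List E) : (T.actList g l).length = l.length := by
  induction l generalizing g with
  | nil => rfl
  | cons a l ih => simp [actList, ih]

theorem isPath_append {v : V} {l m : List E} (hl : T.IsPath v l)
    (hm : T.IsPath (T.endpoint v l) m) : T.IsPath v (l ++ m) := by
  induction l generalizing v with
  | nil => exact hm
  | cons a l ih => exact ⟨hl.1, ih hl.2 hm⟩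

theorem endpoint_append (v : V) (l m : List E) :
    T.endpoint v (l ++ m) = T.endpoint (T.endpoint v l) m := by
  induction l generalizing v with
  | nil => rfl
  | cons a l ih => exact ih _

theorem isPath_actList (g h : G) {v : V} {l : List E} (hg : ∀ w : V, g • w = h • w)
    (hl : T.IsPath v l) : T.IsPath (h • v) (T.actList g l) := by
  induction l generalizing v g with
  | nil => trivial
  | cons a l ih =>
    refine ⟨by rw [T.r_smul, hl.1, hg], ?_⟩
    rw [T.s_smul, hg]
    exact ih _ (fun w => (T.φ_smul g a w).trans (hg w)) hl.2

theorem endpoint_actList (g h : G) (v : V) (l : List E) (hg : ∀ w : V, g • w = h • w) :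
    T.endpoint (h • v) (T.actList g l) = h • T.endpoint v l := by
  induction l generalizing v g with
  | nil => rfl
  | cons a l ih =>
    change T.endpoint (T.s (g • a)) (T.actList (T.φ g a) l) = h • T.endpoint (T.s a) l
    rw [T.s_smul, hg]
    exact ih _ _ (fun w => (T.φ_smul g a w).trans (hg w))

/-- The finite paths of the graph (including the vertices, as the paths of length zero). -/
@[ext]
structure FinPath where
  rng : V
  edges : List E
  valid : T.IsPath rng edges

/-- The infinite paths `a₀ a₁ a₂ ⋯` of the graph. -/
@[ext]
structure InfPath where
  edge : ℕ → E
  valid : ∀ n, T.s (edge n) = T.r (edge (n + 1))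

variable {T}

namespace FinPath

/-- The source `d(α)` of a finite path. -/
def src (α : T.FinPath) : V := T.endpoint α.rng α.edges

/-- The length `|α|` of a finite path. -/
def length (α : T.FinPath) : ℕ := α.edges.length

/-- The concatenation `αβ` of finite paths. -/
def append (α β : T.FinPath) (h : α.src = β.rng) : T.FinPath where
  rng := α.rng
  edges := α.edges ++ β.edges
  valid := T.isPath_append α.valid (by
    have hb := β.valid
    rw [← h] at hb
    exact hb)

theorem src_append (α β : T.FinPath) (h : α.src = β.rng) : (α.append β h).src = β.src := by
  have h' : T.endpoint α.rng α.edges = β.rng := h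
  simp only [src, append, endpoint_append, h']

/-- The action of `G` on finite paths. -/
def act (g : G) (α : T.FinPath) : T.FinPath where
  rng := g • α.rng
  edges := T.actList g α.edges
  valid := T.isPath_actList g g (fun _ => rfl) α.valid

theorem src_act (g : G) (α : T.FinPath) : (α.act g).src = g • α.src :=
  T.endpoint_actList g g _ _ fun _ => rfl

/-- The extension of `φ` to finite paths. -/
def coc (g : G) (α : T.FinPath) : G := T.cocList g α.edges

theorem coc_smul (g : G) (α : T.FinPath) (v : V) : α.coc g • v = g • v :=
  T.cocList_smul g _ v

/-- The path of length zero at a vertex. -/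
def ofVertex (v : V) : T.FinPath := ⟨v, [], trivial⟩

end FinPath

namespace InfPath

/-- The range of an infinite path. -/
def rng (ξ : T.InfPath) : V := T.r (ξ.edge 0)

/-- The list of the first `n` edges of `ξ`. -/
def take (ξ : T.InfPath) (n : ℕ) : List E := (List.range n).map ξ.edge

theorem take_succ (ξ : T.InfPath) (n : ℕ) : ξ.take (n + 1) = ξ.take n ++ [ξ.edge n] := by
  simp [take, List.range_succ]

/-- The action of `G` on infinite paths, `(gξ)ₙ = φ(g, ξ|ₙ) ξₙ`: it is the only map such that the
initial segments of `gξ` are the paths `g (ξ|ₙ)`. -/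
def act (g : G) (ξ : T.InfPath) : T.InfPath where
  edge n := T.cocList g (ξ.take n) • ξ.edge n
  valid n := by rw [T.s_smul, T.r_smul, cocList_smul, cocList_smul, ξ.valid]

/-- The sequence `Φ(g, ξ)` with entries `φ(g, ξ|ₙ)`, `n = 0, 1, 2, …`. -/
def Phi (g : G) (ξ : T.InfPath) : ℕ → G := fun n => T.cocList g (ξ.take n)

theorem rng_act (g : G) (ξ : T.InfPath) : (ξ.act g).rng = g • ξ.rng := by
  simp [rng, act, take, cocList, T.r_smul]

end InfPath

theorem prepend_valid {v : V} {l : List E} (hl : T.IsPath v l) (ξ : T.InfPath)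
    (h : T.endpoint v l = ξ.rng) :
    T.r (l.getD 0 (ξ.edge (0 - l.length))) = v ∧
    ∀ n, T.s (l.getD n (ξ.edge (n - l.length))) =
      T.r (l.getD (n + 1) (ξ.edge (n + 1 - l.length))) := by
  induction l generalizing v with
  | nil => exact ⟨h.symm, fun n => by simpa using ξ.valid n⟩
  | cons a l ih =>
    obtain ⟨h1, h2⟩ := ih hl.2 h
    refine ⟨by simpa using hl.1, fun n => ?_⟩
    cases n with
    | zero => simpa using h1.symm
    | succ n => simpa using h2 n

/-- The infinite path `αξ`. -/
def FinPath.prepend (α : T.FinPath) (ξ : T.InfPath) (h : α.src = ξ.rng) : T.InfPath where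
  edge n := α.edges.getD n (ξ.edge (n - α.length))
  valid := (prepend_valid α.valid ξ h).2

theorem FinPath.rng_prepend (α : T.FinPath) (ξ : T.InfPath) (h : α.src = ξ.rng) :
    (α.prepend ξ h).rng = α.rng := (prepend_valid α.valid ξ h).1

/-! Calculation rules for paths, used to see that the groupoid of germs is well defined. -/

theorem φ_one (a : E) : T.φ 1 a = 1 := by
  have h := T.φ_mul 1 1 a
  simpa using h

theorem cocList_one (l : List E) : T.cocList 1 l = 1 := by
  induction l with
  | nil => rfl
  | cons a l ih => simpa [cocList, T.φ_one] using ih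

theorem cocList_mul (g h : G) (l : List E) :
    T.cocList (g * h) l = T.cocList g (T.actList h l) * T.cocList h l := by
  induction l generalizing g h with
  | nil => rfl
  | cons a l ih => simp [cocList, actList, T.φ_mul, ih]

theorem actList_append (g : G) (l m : List E) :
    T.actList g (l ++ m) = T.actList g l ++ T.actList (T.cocList g l) m := by
  induction l generalizing g with
  | nil => rfl
  | cons a l ih => simp [cocList, actList, ih]

theorem actList_mul (g h : G) (l : List E) :
    T.actList (g * h) l = T.actList g (T.actList h l) := by
  induction l generalizing g h with
  | nil => rfl
  | cons a l ih => simp [actList, T.φ_mul, ih, mul_smul]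

theorem actList_one (l : List E) : T.actList 1 l = l := by
  induction l with
  | nil => rfl
  | cons a l ih => simp [actList, T.φ_one, ih]

namespace FinPath

theorem act_mul (g h : G) (ε : T.FinPath) : ε.act (g * h) = (ε.act h).act g :=
  FinPath.ext (mul_smul _ _ _) (T.actList_mul _ _ _)

theorem act_one (ε : T.FinPath) : ε.act (1 : G) = ε :=
  FinPath.ext (one_smul _ _) (T.actList_one _)

theorem coc_one (ε : T.FinPath) : ε.coc (1 : G) = 1 := T.cocList_one _

theorem coc_inv_act (g : G) (ε : T.FinPath) : (ε.act g).coc g⁻¹ = (ε.coc g)⁻¹ := by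
  have h := T.cocList_mul g⁻¹ g ε.edges
  rw [inv_mul_cancel, cocList_one] at h
  exact eq_inv_of_mul_eq_one_left h.symm

theorem length_append (α β : T.FinPath) (h : α.src = β.rng) :
    (α.append β h).length = α.length + β.length := List.length_append

theorem length_act (g : G) (α : T.FinPath) : (α.act g).length = α.length := T.length_actList _ _

theorem append_cancel {α ε ε' : T.FinPath} {h : α.src = ε.rng} {h' : α.src = ε'.rng}
    (e : α.append ε h = α.append ε' h') : ε = ε' :=
  FinPath.ext (h.symm.trans h') (List.append_cancel_left (congrArg FinPath.edges e))

end FinPath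

namespace InfPath

theorem act_mul (g h : G) (ξ : T.InfPath) : ξ.act (g * h) = (ξ.act h).act g := by
  have key : ∀ n, (ξ.act h).take n = T.actList h (ξ.take n) := by
    intro n
    induction n with
    | zero => rfl
    | succ n ih => rw [take_succ, take_succ, actList_append, ih]; rfl
  ext n
  change T.cocList (g * h) _ • _ = T.cocList g ((ξ.act h).take n) • (T.cocList h _ • _)
  rw [key, cocList_mul, mul_smul]

theorem Phi_mul (g h : G) (ξ : T.InfPath) :
    ξ.Phi (g * h) = (ξ.act h).Phi g * ξ.Phi h := by
  have key : ∀ n, (ξ.act h).take n = T.actList h (ξ.take n) := by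
    intro n
    induction n with
    | zero => rfl
    | succ n ih => rw [take_succ, take_succ, actList_append, ih]; rfl
  funext n
  change T.cocList (g * h) _ = T.cocList g ((ξ.act h).take n) * T.cocList h _
  rw [key, cocList_mul]

theorem act_one (ξ : T.InfPath) : ξ.act (1 : G) = ξ := by
  ext n
  change T.cocList 1 _ • _ = _
  rw [cocList_one, one_smul]

theorem Phi_one (ξ : T.InfPath) : ξ.Phi (1 : G) = 1 := funext fun _ => T.cocList_one _

end InfPath

theorem FinPath.prepend_edge_add (α : T.FinPath) (ξ : T.InfPath) (h : α.src = ξ.rng) (n : ℕ) :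
    (α.prepend ξ h).edge (α.length + n) = ξ.edge n := by
  simp [prepend, length]

theorem FinPath.prepend_edge_lt (α : T.FinPath) (ξ : T.InfPath) (h : α.src = ξ.rng) (n : ℕ)
    (hn : n < α.edges.length) : (α.prepend ξ h).edge n = α.edges[n] := by
  simp [prepend, hn]

theorem FinPath.take_prepend (α : T.FinPath) (ξ : T.InfPath) (h : α.src = ξ.rng) (n : ℕ) :
    (α.prepend ξ h).take (α.length + n) = α.edges ++ ξ.take n := by
  induction n with
  | zero =>
    refine List.ext_getElem (by simp [InfPath.take, length]) fun i h1 h2 => ?_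
    have h3 : i < α.edges.length := by simpa [InfPath.take, length] using h1
    simp [InfPath.take, prepend_edge_lt _ _ _ _ h3]
  | succ n ih =>
    rw [← add_assoc, InfPath.take_succ, ih, InfPath.take_succ, prepend_edge_add, List.append_assoc]

theorem InfPath.ext_take {ξ η : T.InfPath} (h : ∀ n, ξ.take n = η.take n) : ξ = η := by
  ext n
  have h1 := h (n + 1)
  rw [take_succ, take_succ, h n] at h1
  simpa using h1

theorem InfPath.take_take (ξ : T.InfPath) {m n : ℕ} (h : m ≤ n) :
    (ξ.take n).take m = ξ.take m := by
  simp [take, ← List.map_take, List.take_range, h]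

theorem InfPath.ext_take_add {ξ η : T.InfPath} (k : ℕ)
    (h : ∀ n, ξ.take (k + n) = η.take (k + n)) : ξ = η := by
  refine ext_take fun n => ?_
  rw [← take_take ξ (Nat.le_add_left n k), ← take_take η (Nat.le_add_left n k), h]

theorem FinPath.prepend_append (α ε : T.FinPath) (ξ : T.InfPath) (h : α.src = ε.rng)
    (h' : (α.append ε h).src = ξ.rng) :
    (α.append ε h).prepend ξ h' = α.prepend (ε.prepend ξ (by rw [← h', src_append]))
      (by rw [rng_prepend, h]) := by
  refine InfPath.ext_take_add (α.length + ε.length) fun n => ?_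
  rw [← length_append _ _ h, take_prepend, length_append, add_assoc, take_prepend, take_prepend]
  simp [append]

theorem FinPath.prepend_inj {α : T.FinPath} {ξ η : T.InfPath} {h : α.src = ξ.rng}
    {h' : α.src = η.rng} (e : α.prepend ξ h = α.prepend η h') : ξ = η := by
  ext n
  rw [← α.prepend_edge_add ξ h, e, prepend_edge_add]

theorem InfPath.take_act (g : G) (ξ : T.InfPath) (n : ℕ) :
    (ξ.act g).take n = T.actList g (ξ.take n) := by
  induction n with
  | zero => rfl
  | succ n ih => rw [take_succ, take_succ, actList_append, ih]; rfl

theorem FinPath.act_prepend (g : G) (ε : T.FinPath) (ξ : T.InfPath) (h : ε.src = ξ.rng) :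
    (ε.prepend ξ h).act g = (ε.act g).prepend (ξ.act (ε.coc g))
      (by rw [src_act, InfPath.rng_act, coc_smul, h]) := by
  refine InfPath.ext_take_add ε.length fun n => ?_
  rw [InfPath.take_act, take_prepend, actList_append]
  conv_rhs => rw [← length_act g ε, take_prepend, InfPath.take_act]
  rfl

theorem FinPath.Phi_prepend (g : G) (ε : T.FinPath) (ξ : T.InfPath) (h : ε.src = ξ.rng) (n : ℕ) :
    (ε.prepend ξ h).Phi g (ε.length + n) = ξ.Phi (ε.coc g) n := by
  unfold InfPath.Phi
  rw [take_prepend, cocList_append]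
  rfl

theorem InfPath.isPath_take (ξ : T.InfPath) (n : ℕ) : T.IsPath ξ.rng (ξ.take n) ∧
    T.endpoint ξ.rng (ξ.take n) = T.r (ξ.edge n) := by
  induction n with
  | zero => exact ⟨trivial, rfl⟩
  | succ n ih =>
    rw [take_succ]
    refine ⟨T.isPath_append ih.1 ⟨ih.2.symm, trivial⟩, ?_⟩
    rw [endpoint_append]
    exact ξ.valid n

/-- The initial segment `ξ|ₙ`, as a finite path. -/
def InfPath.initial (ξ : T.InfPath) (n : ℕ) : T.FinPath := ⟨ξ.rng, ξ.take n, (ξ.isPath_take n).1⟩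

/-- The infinite path that remains when the first `n` edges of `ξ` are deleted. -/
def InfPath.drop (ξ : T.InfPath) (n : ℕ) : T.InfPath :=
  ⟨fun k => ξ.edge (n + k), fun k => ξ.valid (n + k)⟩

theorem InfPath.length_initial (ξ : T.InfPath) (n : ℕ) : (ξ.initial n).length = n := by
  simp [initial, FinPath.length, take]

theorem InfPath.src_initial (ξ : T.InfPath) (n : ℕ) : (ξ.initial n).src = (ξ.drop n).rng :=
  (ξ.isPath_take n).2

theorem InfPath.take_add (ξ : T.InfPath) (m n : ℕ) :
    ξ.take (m + n) = ξ.take m ++ (ξ.drop m).take n := by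
  induction n with
  | zero => simp [take]
  | succ n ih => rw [← add_assoc, take_succ, ih, take_succ, List.append_assoc]; rfl

theorem InfPath.initial_prepend_drop (ξ : T.InfPath) (n : ℕ) :
    (ξ.initial n).prepend (ξ.drop n) (ξ.src_initial n) = ξ := by
  refine ext_take_add n fun k => ?_
  have h := (ξ.initial n).take_prepend (ξ.drop n) (ξ.src_initial n) k
  rw [length_initial] at h
  rw [h, take_add]
  rfl

/-- Two finite initial segments of an infinite path are comparable. -/
theorem FinPath.exists_append {α β : T.FinPath} {ξ η : T.InfPath} {h : α.src = ξ.rng}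
    {h' : β.src = η.rng} (e : α.prepend ξ h = β.prepend η h') (hl : β.length ≤ α.length) :
    ∃ (ε : T.FinPath) (k : β.src = ε.rng) (l : ε.src = ξ.rng),
      α = β.append ε k ∧ η = ε.prepend ξ l := by
  have k : β.src = (η.initial (α.length - β.length)).rng := h'
  have hα : α = β.append (η.initial (α.length - β.length)) k := by
    refine FinPath.ext ?_ ?_
    · change α.rng = β.rng
      rw [← α.rng_prepend ξ h, e, rng_prepend]
    · change α.edges = β.edges ++ η.take _
      rw [← β.take_prepend η h', ← e, Nat.add_sub_cancel' hl]
      have := α.take_prepend ξ h 0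
      simpa [InfPath.take] using this.symm
  have l : (η.initial (α.length - β.length)).src = ξ.rng := by
    rw [← h]
    conv_rhs => rw [hα, src_append]
  refine ⟨_, k, l, hα, ?_⟩
  have h2 : (β.append (η.initial (α.length - β.length)) k).src = ξ.rng := by
    rw [src_append, l]
  have e2 : (β.append (η.initial (α.length - β.length)) k).prepend ξ h2 = β.prepend η h' := by
    rw [← e]
    congr 1
    exact hα.symm
  rw [prepend_append] at e2
  exact (prepend_inj e2).symm

variable (T) in
/-- The nonzero elements `(α, g, β)` of the inverse semigroup `S_{G,E}`. -/
@[ext]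
structure Triple where
  α : T.FinPath
  g : G
  β : T.FinPath
  src_eq : α.src = g • β.src

variable (T) in
/-- The inverse semigroup `S_{G,E}`, consisting of the triples and a zero. -/
abbrev Semigp : Type _ := Option T.Triple

namespace Triple

theorem mul_aux₁ (y : T.Triple) (ε : T.FinPath) (h : y.α.src = ε.rng) :
    y.β.src = (ε.act y.g⁻¹).rng := by
  change _ = y.g⁻¹ • ε.rng
  rw [← h, y.src_eq, inv_smul_smul]

theorem mul_aux₂ (x y : T.Triple) (ε : T.FinPath) (h : y.α.src = ε.rng)
    (e : x.β = y.α.append ε h) :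
    x.α.src = (x.g * (ε.coc y.g⁻¹)⁻¹) •
      (y.β.append (ε.act y.g⁻¹) (mul_aux₁ y ε h)).src := by
  rw [FinPath.src_append, FinPath.src_act, x.src_eq, e, FinPath.src_append, mul_smul,
    ← FinPath.coc_smul y.g⁻¹ ε, inv_smul_smul]

theorem mul_aux₃ (x : T.Triple) (ε : T.FinPath) (h : x.β.src = ε.rng) :
    x.α.src = (ε.act x.g).rng := by
  change _ = x.g • ε.rng
  rw [← h, x.src_eq]

theorem mul_aux₄ (x y : T.Triple) (ε : T.FinPath) (h : x.β.src = ε.rng)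
    (e : y.α = x.β.append ε h) :
    (x.α.append (ε.act x.g) (mul_aux₃ x ε h)).src = (ε.coc x.g * y.g) • y.β.src := by
  rw [FinPath.src_append, FinPath.src_act, mul_smul, ← y.src_eq, e, FinPath.src_append,
    FinPath.coc_smul]

open scoped Classical in
/-- The product of two triples:
`(α, g, β) (γ, h, δ)` is `(α, g φ(h⁻¹, ε)⁻¹, δ (h⁻¹ε))` if `β = γε`, it is
`(α (gε), φ(g, ε) h, δ)` if `γ = βε`, and it is zero otherwise. -/
noncomputable def mul (x y : T.Triple) : T.Semigp :=
  if h : ∃ (ε : T.FinPath) (h : y.α.src = ε.rng), x.β = y.α.append ε h then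
    some ⟨x.α, x.g * (h.choose.coc y.g⁻¹)⁻¹,
      y.β.append (h.choose.act y.g⁻¹)
        (mul_aux₁ y _ h.choose_spec.choose),
      mul_aux₂ x y _ h.choose_spec.choose h.choose_spec.choose_spec⟩
  else if h : ∃ (ε : T.FinPath) (h : x.β.src = ε.rng), y.α = x.β.append ε h then
    some ⟨x.α.append (h.choose.act x.g) (mul_aux₃ x _ h.choose_spec.choose),
      h.choose.coc x.g * y.g, y.β,
      mul_aux₄ x y _ h.choose_spec.choose h.choose_spec.choose_spec⟩
  else none

theorem mul_of_left (x y : T.Triple) (ε : T.FinPath) (h : y.α.src = ε.rng)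
    (e : x.β = y.α.append ε h) :
    x.mul y = some ⟨x.α, x.g * (ε.coc y.g⁻¹)⁻¹, y.β.append (ε.act y.g⁻¹) (mul_aux₁ y ε h),
      mul_aux₂ x y ε h e⟩ := by
  have H : ∃ (ε : T.FinPath) (h : y.α.src = ε.rng), x.β = y.α.append ε h := ⟨ε, h, e⟩
  have hε : H.choose = ε :=
    FinPath.append_cancel (H.choose_spec.choose_spec.symm.trans e)
  rw [mul, dif_pos H]
  congr 2 <;> simp only [hε]

theorem mul_of_right (x y : T.Triple) (ε : T.FinPath) (h : x.β.src = ε.rng)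
    (e : y.α = x.β.append ε h) (hl : x.β.length < y.α.length) :
    x.mul y = some ⟨x.α.append (ε.act x.g) (mul_aux₃ x ε h), ε.coc x.g * y.g, y.β,
      mul_aux₄ x y ε h e⟩ := by
  have H0 : ¬ ∃ (ε : T.FinPath) (h : y.α.src = ε.rng), x.β = y.α.append ε h := by
    rintro ⟨ε', h', e'⟩
    rw [e', FinPath.length_append] at hl
    omega
  have H : ∃ (ε : T.FinPath) (h : x.β.src = ε.rng), y.α = x.β.append ε h := ⟨ε, h, e⟩
  have hε : H.choose = ε :=
    FinPath.append_cancel (H.choose_spec.choose_spec.symm.trans e)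
  rw [mul, dif_neg H0, dif_pos H]
  congr 2 <;> simp only [hε]

/-- `(α, g, β)* = (β, g⁻¹, α)`. -/
def star (x : T.Triple) : T.Triple := ⟨x.β, x.g⁻¹, x.α, by rw [x.src_eq, inv_smul_smul]⟩

/-- The element `(α, 1, β)`, where `d(α) = d(β)`. -/
def ofPair (α β : T.FinPath) (h : α.src = β.src) : T.Triple := ⟨α, 1, β, by rw [one_smul, h]⟩

end Triple

namespace Semigp

/-- The product of `S_{G,E}`. -/
noncomputable def mul : T.Semigp → T.Semigp → T.Semigp
  | some x, some y => x.mul y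
  | _, _ => none

/-- The action of `S_{G,E}` on infinite paths: `η = βξ` lies in the domain of `(α, g, β)`, which
maps it to `ζ = α (gξ)`. -/
def Maps (e : T.Semigp) (η ζ : T.InfPath) : Prop :=
  ∃ (x : T.Triple) (ξ : T.InfPath) (h : x.β.src = ξ.rng) (k : x.α.src = (ξ.act x.g).rng),
    e = some x ∧ η = x.β.prepend ξ h ∧ ζ = x.α.prepend (ξ.act x.g) k

end Semigp

variable (T) in
/-- The pairs `((α, g, β), βξ)`, which represent the germs. -/
@[ext]
structure PreGerm where
  x : T.Triple
  ξ : T.InfPath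
  src_eq : x.β.src = ξ.rng

namespace PreGerm

/-- The infinite path `βξ`. -/
def base (p : T.PreGerm) : T.InfPath := p.x.β.prepend p.ξ p.src_eq

theorem act_eq (p : T.PreGerm) : p.x.α.src = (p.ξ.act p.x.g).rng := by
  rw [InfPath.rng_act, p.x.src_eq, p.src_eq]

/-- The infinite path `α (gξ)`. -/
def target (p : T.PreGerm) : T.InfPath := p.x.α.prepend (p.ξ.act p.x.g) p.act_eq

/-- Equality of germs: `[x; η] = [y; μ]` if `η = μ` and there is an idempotent `e ≠ 0` of
`S_{G,E}` with `e η = η` and `x e = y e`. -/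
def Rel (p q : T.PreGerm) : Prop :=
  p.base = q.base ∧ ∃ e : T.Semigp, e ≠ none ∧ e.mul e = e ∧ e.Maps p.base p.base ∧
    Semigp.mul (some p.x) e = Semigp.mul (some q.x) e

/-- The value `(ρ^|α| (Φ(g, ξ)), |α| - |β|)` of the lag function on a representative. -/
def lag (p : T.PreGerm) : LagGroup G :=
  ⟨coronaAction G (Multiplicative.ofAdd (p.x.α.length : ℤ))
      (QuotientGroup.mk (p.ξ.Phi p.x.g) : Corona G),
    Multiplicative.ofAdd ((p.x.α.length : ℤ) - p.x.β.length)⟩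


theorem lag_eq_iff (p q : T.PreGerm) : p.lag = q.lag ↔
    p.x.α.length + q.x.β.length = q.x.α.length + p.x.β.length ∧
    ∃ N, ∀ n ≥ N, p.ξ.Phi p.x.g (q.x.α.length + n) = q.ξ.Phi q.x.g (p.x.α.length + n) := by
  rw [← coronaAction_eq_iff, SemidirectProduct.ext_iff, and_comm]
  refine and_congr ?_ Iff.rfl
  change Multiplicative.ofAdd _ = Multiplicative.ofAdd _ ↔ _
  rw [Multiplicative.ofAdd.injective.eq_iff]
  omega

/-- The product of germs on representatives, and its values under range, source and lag. -/
theorem exists_mul (p q : T.PreGerm) (h : p.base = q.target) :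
    ∃ w : T.PreGerm, Semigp.mul (some p.x) (some q.x) = some w.x ∧ w.base = q.base ∧
      w.target = p.target ∧ w.lag = p.lag * q.lag := by
  rcases le_or_gt q.x.α.length p.x.β.length with hl | hl
  · obtain ⟨ε, k, l, e1, e2⟩ := FinPath.exists_append h hl
    have e3 : q.ξ = (q.ξ.act q.x.g).act q.x.g⁻¹ := by
      rw [← InfPath.act_mul, inv_mul_cancel, InfPath.act_one]
    rw [e2, FinPath.act_prepend] at e3
    have hs : (q.x.β.append (ε.act q.x.g⁻¹) (Triple.mul_aux₁ q.x ε k)).src =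
        (p.ξ.act (ε.coc q.x.g⁻¹)).rng := by
      rw [FinPath.src_append, FinPath.src_act, InfPath.rng_act, FinPath.coc_smul, l]
    have ha : (p.ξ.act (ε.coc q.x.g⁻¹)).act (p.x.g * (ε.coc q.x.g⁻¹)⁻¹) = p.ξ.act p.x.g := by
      rw [← InfPath.act_mul, inv_mul_cancel_right]
    refine ⟨⟨⟨p.x.α, p.x.g * (ε.coc q.x.g⁻¹)⁻¹, _, Triple.mul_aux₂ p.x q.x ε k e1⟩,
      p.ξ.act (ε.coc q.x.g⁻¹), hs⟩, Triple.mul_of_left p.x q.x ε k e1, ?_, ?_, ?_⟩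
    · simp only [base]
      rw [FinPath.prepend_append]
      congr 1
      exact e3.symm
    · simp only [target, ha]
    · refine SemidirectProduct.ext ?_ ?_
      · rw [SemidirectProduct.mul_left]
        simp only [lag]
        rw [← MulAut.mul_apply, ← map_mul, ← ofAdd_add]
        have e4 : ((p.x.α.length : ℤ) - p.x.β.length + q.x.α.length) =
            p.x.α.length + -((ε.act q.x.g⁻¹).length : ℤ) := by
          rw [e1, FinPath.length_append, FinPath.length_act]
          push_cast
          ring
        rw [e4, ofAdd_add, map_mul, MulAut.mul_apply, coronaAction_neg, ← map_mul,
          InfPath.Phi_mul]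
        congr 1
        rw [QuotientGroup.mk_mul]
        congr 2
        · rw [← InfPath.act_mul, inv_mul_cancel, InfPath.act_one]
        · funext n
          have e5 : (ε.act q.x.g⁻¹).coc q.x.g = (ε.coc q.x.g⁻¹)⁻¹ := by
            have := ε.coc_inv_act q.x.g⁻¹
            rwa [inv_inv] at this
          conv_rhs => rw [e3]
          rw [FinPath.Phi_prepend, e5]
      · rw [SemidirectProduct.mul_right]
        simp only [lag]
        rw [← ofAdd_add]
        congr 1
        rw [FinPath.length_append, FinPath.length_act, e1, FinPath.length_append]
        push_cast
        ring
  · obtain ⟨ε, k, l, e1, e2⟩ := FinPath.exists_append h.symm hl.le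
    have ha : (p.x.α.append (ε.act p.x.g) (Triple.mul_aux₃ p.x ε k)).src =
        (q.ξ.act (ε.coc p.x.g * q.x.g)).rng := by
      rw [FinPath.src_append, FinPath.src_act, InfPath.rng_act, mul_smul, FinPath.coc_smul,
        ← InfPath.rng_act, l]
    refine ⟨⟨⟨_, ε.coc p.x.g * q.x.g, q.x.β, Triple.mul_aux₄ p.x q.x ε k e1⟩, q.ξ, q.src_eq⟩,
      Triple.mul_of_right p.x q.x ε k e1 hl, rfl, ?_, ?_⟩
    · simp only [target]
      rw [FinPath.prepend_append]
      congr 1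
      rw [e2, FinPath.act_prepend]
      congr 1
      rw [InfPath.act_mul]
    · refine SemidirectProduct.ext ?_ ?_
      · rw [SemidirectProduct.mul_left]
        simp only [lag]
        rw [← MulAut.mul_apply, ← map_mul, ← ofAdd_add]
        have e4 : ((p.x.α.length : ℤ) - p.x.β.length + q.x.α.length) =
            ((p.x.α.append (ε.act p.x.g) (Triple.mul_aux₃ p.x ε k)).length : ℤ) := by
          rw [e1, FinPath.length_append, FinPath.length_append, FinPath.length_act]
          push_cast
          ring
        rw [e4, InfPath.Phi_mul, QuotientGroup.mk_mul, map_mul]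
        congr 1
        refine (coronaAction_eq_iff _ _ _ _).2 ⟨0, fun n _ => ?_⟩
        rw [FinPath.length_append, FinPath.length_act, e2, add_comm p.x.α.length ε.length,
          add_assoc, FinPath.Phi_prepend]
      · rw [SemidirectProduct.mul_right]
        simp only [lag]
        rw [← ofAdd_add]
        congr 1
        rw [FinPath.length_append, FinPath.length_act, e1, FinPath.length_append]
        push_cast
        ring

theorem mul_idem (p : T.PreGerm) (m : ℕ) (hm : 0 < m) :
    ∃ t : T.Triple,
      Semigp.mul (some p.x) (some (Triple.ofPair (p.base.initial (p.x.β.length + m))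
        (p.base.initial (p.x.β.length + m)) rfl)) = some t ∧
      t.β = p.base.initial (p.x.β.length + m) ∧ t.g = p.ξ.Phi p.x.g m ∧
      t.α = p.target.initial (p.x.α.length + m) := by
  have h := p.base.initial_prepend_drop (p.x.β.length + m)
  have hl : p.x.β.length < (p.base.initial (p.x.β.length + m)).length := by
    rw [InfPath.length_initial]
    omega
  obtain ⟨ε, k, l, e1, e2⟩ := FinPath.exists_append (h' := p.src_eq) h hl.le
  have hε : ε.length = m := by
    have := congrArg FinPath.length e1
    rw [InfPath.length_initial, FinPath.length_append] at this
    omega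
  have hε' : ε.edges = p.ξ.take m := by
    have := FinPath.take_prepend ε _ l 0
    rw [← e2, hε] at this
    simpa [InfPath.take] using this.symm
  refine ⟨_, Triple.mul_of_right p.x _ ε k e1 hl, rfl, ?_, ?_⟩
  · simp [Triple.ofPair, FinPath.coc, InfPath.Phi, hε']
  · refine FinPath.ext (FinPath.rng_prepend p.x.α _ p.act_eq).symm ?_
    change p.x.α.edges ++ T.actList p.x.g ε.edges = p.target.take _
    rw [target, FinPath.take_prepend, InfPath.take_act, hε']

theorem ext_base (p q : T.PreGerm) (hx : p.x = q.x) (h : p.base = q.base) : p = q := by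
  obtain ⟨x, ξ, h1⟩ := p
  obtain ⟨y, η, h2⟩ := q
  obtain rfl : x = y := hx
  obtain rfl : ξ = η := FinPath.prepend_inj h
  rfl

/-- A germ is determined by its source, its range and its lag. -/
theorem rel_iff (p q : T.PreGerm) :
    p.Rel q ↔ p.base = q.base ∧ p.target = q.target ∧ p.lag = q.lag := by
  refine and_congr_right fun hb => ⟨?_, ?_⟩
  · rintro ⟨e, -, -, ⟨x, ξ, h, k, rfl, h1, h2⟩, h3⟩
    obtain ⟨w, hw1, hw2, hw3, hw4⟩ := exists_mul p ⟨x, ξ, h⟩ h2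
    obtain ⟨w', hw1', hw2', hw3', hw4'⟩ := exists_mul q ⟨x, ξ, h⟩ (hb.symm.trans h2)
    have e1 : w = w' := by
      refine ext_base _ _ ?_ (hw2.trans hw2'.symm)
      have h4 : some w.x = some w'.x := hw1.symm.trans (h3.trans hw1')
      exact Option.some.inj h4
    subst e1
    exact ⟨hw3.symm.trans hw3', mul_right_cancel (hw4.symm.trans hw4')⟩
  · rintro ⟨ht, hlag⟩
    obtain ⟨hlen, N, hN⟩ := (lag_eq_iff p q).1 hlag
    obtain ⟨t, ht1, ht2, ht3, ht4⟩ := mul_idem p (q.x.α.length + N + 1) (by omega)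
    obtain ⟨t', ht1', ht2', ht3', ht4'⟩ := mul_idem q (p.x.α.length + N + 1) (by omega)
    have hL : q.x.β.length + (p.x.α.length + N + 1) =
        p.x.β.length + (q.x.α.length + N + 1) := by omega
    have htt : t = t' := by
      refine Triple.ext ?_ ?_ ?_
      · rw [ht4, ht4', ht]
        congr 1
        omega
      · rw [ht3, ht3', add_assoc, add_assoc, hN (N + 1) (by omega)]
      · rw [ht2, ht2', hb, hL]
    rw [hL, ← hb] at ht1'
    set τ := p.base.initial (p.x.β.length + (q.x.α.length + N + 1)) with hτ
    refine ⟨some (Triple.ofPair τ τ rfl), by simp, ?_, ?_, ?_⟩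
    · have h0 : τ.src = (FinPath.ofVertex (T := T) τ.src).rng := rfl
      have h1 : τ = τ.append (FinPath.ofVertex τ.src) h0 :=
        FinPath.ext rfl (List.append_nil _).symm
      refine (Triple.mul_of_left (Triple.ofPair τ τ rfl) (Triple.ofPair τ τ rfl) _ h0 h1).trans ?_
      congr 1
      refine Triple.ext rfl ?_ ?_
      · simp [Triple.ofPair, FinPath.coc_one]
      · exact FinPath.ext rfl (List.append_nil _)
    · refine ⟨Triple.ofPair τ τ rfl, p.base.drop _, InfPath.src_initial _ _, ?_, rfl, ?_, ?_⟩
      · simp only [Triple.ofPair, InfPath.act_one]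
        exact InfPath.src_initial _ _
      · exact (InfPath.initial_prepend_drop _ _).symm
      · simp only [Triple.ofPair, InfPath.act_one]
        exact (InfPath.initial_prepend_drop _ _).symm
    · rw [ht1, ht1', htt]

/-- The representative `(x*, x (βξ))` of the inverse germ. -/
def inv (p : T.PreGerm) : T.PreGerm := ⟨p.x.star, p.ξ.act p.x.g, p.act_eq⟩

theorem target_inv (p : T.PreGerm) : p.inv.target = p.base := by
  simp only [target, base, inv, Triple.star]
  congr 1
  rw [← InfPath.act_mul, inv_mul_cancel, InfPath.act_one]

theorem lag_inv (p : T.PreGerm) : p.inv.lag = p.lag⁻¹ := by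
  refine eq_inv_of_mul_eq_one_left ?_
  refine SemidirectProduct.ext ?_ ?_
  · rw [SemidirectProduct.mul_left]
    simp only [lag, inv, Triple.star]
    rw [← MulAut.mul_apply, ← map_mul, ← ofAdd_add, sub_add_cancel, ← map_mul,
      ← QuotientGroup.mk_mul, ← InfPath.Phi_mul, inv_mul_cancel, InfPath.Phi_one,
      QuotientGroup.mk_one, map_one]
    rfl
  · rw [SemidirectProduct.mul_right]
    simp only [lag, inv, Triple.star]
    rw [← ofAdd_add, sub_add_sub_cancel, sub_self]
    rfl

/-- The representative `(v, 1, v; η)` of the unit at the infinite path `η`, with `v` the range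
of `η`. -/
def unit (η : T.InfPath) : T.PreGerm :=
  ⟨Triple.ofPair (FinPath.ofVertex η.rng) (FinPath.ofVertex η.rng) rfl, η, rfl⟩

theorem base_unit (η : T.InfPath) : (unit η).base = η := by
  ext n
  simp [unit, base, Triple.ofPair, FinPath.ofVertex, FinPath.prepend, FinPath.length]

theorem target_unit (η : T.InfPath) : (unit η).target = η := by
  ext n
  simp [unit, target, Triple.ofPair, FinPath.ofVertex, FinPath.prepend, FinPath.length,
    InfPath.act_one]

theorem lag_unit (η : T.InfPath) : (unit η).lag = 1 := by
  refine SemidirectProduct.ext ?_ ?_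
  · simp only [lag, unit, Triple.ofPair]
    rw [InfPath.Phi_one, QuotientGroup.mk_one, map_one]
    rfl
  · simp only [lag, unit, Triple.ofPair, sub_self]
    rfl

variable (T) in
/-- Equality of germs is an equivalence relation on the representatives. -/
def setoid : Setoid T.PreGerm where
  r := Rel
  iseqv :=
    { refl := fun p => (rel_iff p p).2 ⟨rfl, rfl, rfl⟩
      symm := fun {p q} h => by
        obtain ⟨h1, h2, h3⟩ := (rel_iff p q).1 h
        exact (rel_iff q p).2 ⟨h1.symm, h2.symm, h3.symm⟩
      trans := fun {p q w} h k => by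
        obtain ⟨h1, h2, h3⟩ := (rel_iff p q).1 h
        obtain ⟨k1, k2, k3⟩ := (rel_iff q w).1 k
        exact (rel_iff p w).2 ⟨h1.trans k1, h2.trans k2, h3.trans k3⟩ }

end PreGerm

variable (T) in
/-- The groupoid of germs `𝒢_(G,E)`, as a set. -/
def Germ : Type _ := Quotient (PreGerm.setoid T)

namespace Germ

/-- The germ `[α, g, β; βξ]` of a representative. -/
def mk (p : T.PreGerm) : T.Germ := Quotient.mk _ p

theorem mk_eq_mk {p q : T.PreGerm} : mk p = mk q ↔ p.Rel q := Quotient.eq (r := PreGerm.setoid T)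

/-- The source `βξ` of `[α, g, β; βξ]`, as an infinite path. -/
def srcPath : T.Germ → T.InfPath :=
  Quotient.lift PreGerm.base fun p q h => ((PreGerm.rel_iff p q).1 h).1

/-- The range `α (gξ)` of `[α, g, β; βξ]`, as an infinite path. -/
def rngPath : T.Germ → T.InfPath :=
  Quotient.lift PreGerm.target fun p q h => ((PreGerm.rel_iff p q).1 h).2.1

/-- The lag function `[α, g, β; βξ] ↦ (ρ^|α| (Φ(g, ξ)), |α| - |β|)`. -/
def lagFun : T.Germ → LagGroup G :=
  Quotient.lift PreGerm.lag fun p q h => ((PreGerm.rel_iff p q).1 h).2.2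

theorem ext' {γ δ : T.Germ} (h1 : γ.srcPath = δ.srcPath) (h2 : γ.rngPath = δ.rngPath)
    (h3 : γ.lagFun = δ.lagFun) : γ = δ := by
  induction γ using Quotient.ind with
  | _ p =>
    induction δ using Quotient.ind with
    | _ q => exact mk_eq_mk.2 ((PreGerm.rel_iff p q).2 ⟨h1, h2, h3⟩)

/-- The unit at an infinite path. -/
def unit (η : T.InfPath) : T.Germ := mk (PreGerm.unit η)

/-- The inverse, `[x; η]⁻¹ = [x*; xη]`. -/
def inv : T.Germ → T.Germ :=
  Quotient.lift (fun p => mk p.inv) fun p q h => by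
    obtain ⟨h1, h2, h3⟩ := (PreGerm.rel_iff p q).1 h
    refine mk_eq_mk.2 ((PreGerm.rel_iff _ _).2 ⟨h2, ?_, ?_⟩)
    · rw [PreGerm.target_inv, PreGerm.target_inv, h1]
    · rw [PreGerm.lag_inv, PreGerm.lag_inv, h3]

/-- The pair `γ`, `δ` has representatives `γ = [x; yη]`, `δ = [y; η]`, and `w` represents
`[xy; η]`. -/
def IsMul (γ δ : T.Germ) (w : T.PreGerm) : Prop :=
  ∃ p q : T.PreGerm, mk p = γ ∧ mk q = δ ∧ p.base = q.target ∧
    Semigp.mul (some p.x) (some q.x) = some w.x ∧ w.base = q.base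

open scoped Classical in
/-- The product of composable germs, `[x; yη] [y; η] = [xy; η]`. -/
noncomputable def mul (γ δ : T.Germ) : T.Germ :=
  if h : ∃ w, IsMul γ δ w then mk h.choose else γ

theorem IsMul.spec {γ δ : T.Germ} {w : T.PreGerm} (h : IsMul γ δ w) :
    (mk w).srcPath = δ.srcPath ∧ (mk w).rngPath = γ.rngPath ∧
      (mk w).lagFun = γ.lagFun * δ.lagFun := by
  obtain ⟨p, q, rfl, rfl, h1, h2, h3⟩ := h
  obtain ⟨w', k1, k2, k3, k4⟩ := PreGerm.exists_mul p q h1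
  have e : w = w' :=
    PreGerm.ext_base _ _ (Option.some.inj (h2.symm.trans k1)) (h3.trans k2.symm)
  subst e
  exact ⟨k2, k3, k4⟩

/-- The product does not depend on the representatives. -/
theorem IsMul.mul_eq {γ δ : T.Germ} {w : T.PreGerm} (h : IsMul γ δ w) : mul γ δ = mk w := by
  have H : ∃ w, IsMul γ δ w := ⟨w, h⟩
  rw [mul, dif_pos H]
  obtain ⟨a1, a2, a3⟩ := H.choose_spec.spec
  obtain ⟨b1, b2, b3⟩ := h.spec
  exact ext' (a1.trans b1.symm) (a2.trans b2.symm) (a3.trans b3.symm)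

theorem mul_spec {γ δ : T.Germ} (h : γ.srcPath = δ.rngPath) :
    (mul γ δ).srcPath = δ.srcPath ∧ (mul γ δ).rngPath = γ.rngPath ∧
      (mul γ δ).lagFun = γ.lagFun * δ.lagFun := by
  induction γ using Quotient.ind with
  | _ p =>
    induction δ using Quotient.ind with
    | _ q =>
      obtain ⟨w, k1, k2, k3, k4⟩ := PreGerm.exists_mul p q h
      have H : IsMul (mk p) (mk q) w := ⟨p, q, rfl, rfl, h, k1, k2⟩
      have e := H.mul_eq
      have := H.spec
      rw [← e] at this
      exact this

theorem srcPath_unit (η : T.InfPath) : (unit η).srcPath = η := PreGerm.base_unit η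

theorem rngPath_unit (η : T.InfPath) : (unit η).rngPath = η := PreGerm.target_unit η

theorem lagFun_unit (η : T.InfPath) : (unit η).lagFun = 1 := PreGerm.lag_unit η

theorem srcPath_inv (γ : T.Germ) : (inv γ).srcPath = γ.rngPath := by
  induction γ using Quotient.ind with
  | _ p => rfl

theorem rngPath_inv (γ : T.Germ) : (inv γ).rngPath = γ.srcPath := by
  induction γ using Quotient.ind with
  | _ p => exact p.target_inv

theorem lagFun_inv (γ : T.Germ) : (inv γ).lagFun = γ.lagFun⁻¹ := by
  induction γ using Quotient.ind with
  | _ p => exact p.lag_inv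

theorem unit_inj {η ζ : T.InfPath} (h : unit η = unit ζ) : η = ζ := by
  rw [← srcPath_unit η, h, srcPath_unit]

/-- The groupoid structure of `𝒢_(G,E)`. -/
noncomputable instance : ArrowGroupoid T.Germ where
  r γ := unit γ.rngPath
  s γ := unit γ.srcPath
  mul := mul
  inv := inv
  s_r γ := by rw [srcPath_unit]
  r_s γ := by rw [rngPath_unit]
  r_mul γ δ h := by rw [(mul_spec (unit_inj h)).2.1]
  s_mul γ δ h := by rw [(mul_spec (unit_inj h)).1]
  mul_assoc γ δ ε h k := by
    have h' := unit_inj h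
    have k' := unit_inj k
    obtain ⟨a1, a2, a3⟩ := mul_spec h'
    obtain ⟨b1, b2, b3⟩ := mul_spec k'
    obtain ⟨c1, c2, c3⟩ := mul_spec (a1.trans k')
    obtain ⟨d1, d2, d3⟩ := mul_spec (h'.trans b2.symm)
    exact ext' (by rw [c1, d1, b1]) (by rw [c2, d2, a2]) (by rw [c3, d3, a3, b3, _root_.mul_assoc])
  r_mul_self γ := by
    obtain ⟨a1, a2, a3⟩ := mul_spec (srcPath_unit γ.rngPath)
    exact ext' a1 (a2.trans (rngPath_unit _)) (by rw [a3, lagFun_unit, one_mul])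
  mul_s_self γ := by
    obtain ⟨a1, a2, a3⟩ := mul_spec (rngPath_unit γ.srcPath).symm
    exact ext' (a1.trans (srcPath_unit _)) a2 (by rw [a3, lagFun_unit, mul_one])
  r_inv γ := by rw [rngPath_inv]
  s_inv γ := by rw [srcPath_inv]
  mul_inv γ := by
    obtain ⟨a1, a2, a3⟩ := mul_spec (rngPath_inv γ).symm
    refine ext' ?_ ?_ ?_
    · rw [a1, srcPath_inv, srcPath_unit]
    · rw [a2, rngPath_unit]
    · rw [a3, lagFun_inv, lagFun_unit, mul_inv_cancel]
  inv_mul γ := by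
    obtain ⟨a1, a2, a3⟩ := mul_spec (srcPath_inv γ)
    refine ext' ?_ ?_ ?_
    · rw [a1, srcPath_unit]
    · rw [a2, rngPath_inv, rngPath_unit]
    · rw [a3, lagFun_inv, lagFun_unit, inv_mul_cancel]

/-- The cylinder `Z(δ)` of all infinite paths `δη`. -/
def cylinder (δ : T.FinPath) : Set T.InfPath :=
  {ζ | ∃ (η : T.InfPath) (h : δ.src = η.rng), ζ = δ.prepend η h}

/-- The set `Θ(α, g, β; Z(δ))` of all germs `[α, g, β; ζ]` with `ζ ∈ Z(δ)`. -/
def Theta (x : T.Triple) (δ : T.FinPath) : Set T.Germ :=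
  {γ | ∃ (ξ : T.InfPath) (h : x.β.src = ξ.rng),
    x.β.prepend ξ h ∈ cylinder δ ∧ γ = mk ⟨x, ξ, h⟩}

/-- The topology of `𝒢_(G,E)`, generated by the sets `Θ(α, g, β; Z(δ))`. -/
instance : TopologicalSpace T.Germ :=
  TopologicalSpace.generateFrom {W | ∃ (x : T.Triple) (δ : T.FinPath), W = Theta x δ}

end Germ

variable (T) in
/-- The lag function, as a cocycle on `𝒢_(G,E)` with values in the lag group. -/
def lagCocycle : ArrowGroupoid.Cocycle T.Germ (LagGroup G) where
  toFun := Germ.lagFun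
  map_mul _ _ h := (Germ.mul_spec (Germ.unit_inj h)).2.2

end

end GraphTriple

/-! The germ `[α, g, β; βξ]` is determined by its source path, its range path and its lag, because
`φ(g, ξ|ₙ)` for large `n` is all that the germ remembers of `g`.  Hence a germ in the kernel of the
lag cocycle whose source and range agree is a unit, that is, the kernel is principal; since the
units form an open set, it is strongly effective.

For the graded ideals, let `c` be any locally constant cocycle with principal kernel on an ample
groupoid, and let `f`, in a graded ideal `J`, be nonzero at the unit `u`.  We may replace `f` by
its component of degree `1`.  Off the units, the compact support of `f` contains no arrow from `u`
to `u`, so for a small compact open set `W` of units around `u` the product `1_W * f * 1_W` is a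
nonzero multiple of `1_W`, and `1_W ∈ J`.  Thus `J` contains the characteristic functions of small
neighbourhoods of the units at which it does not vanish, and these generate `A_K(𝒢|_U)` for the
open invariant set `U` of these units. -/

namespace ArrowGroupoid

section Algebra

variable {𝒢 : Type*} [ArrowGroupoid 𝒢]

protected theorem inv_inv (γ : 𝒢) : inv (inv γ) = γ := by
  have h := mul_assoc (inv (inv γ)) (inv γ) γ (s_inv _) (s_inv γ)
  rwa [inv_mul, inv_mul, s_inv γ, r_mul_self, ← r_inv γ, ← s_inv (inv γ), mul_s_self, eq_comm] at h

theorem eq_inv_mul {α β γ : 𝒢} (h : s α = r β) (e : mul α β = γ) : β = mul (inv α) γ := by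
  rw [← e, ← mul_assoc _ _ _ (s_inv α) h, inv_mul, h, r_mul_self]

theorem eq_mul_inv {α β γ : 𝒢} (h : s α = r β) (e : mul α β = γ) : α = mul γ (inv β) := by
  rw [← e, mul_assoc _ _ _ h (r_inv β).symm, mul_inv, ← h, mul_s_self]

theorem mul_inv_mul {α γ : 𝒢} (h : r α = r γ) : mul α (mul (inv α) γ) = γ := by
  rw [← mul_assoc _ _ _ (r_inv α).symm ((s_inv α).trans h), mul_inv, h, r_mul_self]

theorem s_eq_r_inv_mul {α γ : 𝒢} (h : r α = r γ) : s α = r (mul (inv α) γ) := by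
  rw [r_mul _ _ ((s_inv α).trans h), r_inv]

theorem r_of_mem_units {u : 𝒢} (h : u ∈ units 𝒢) : r u = u := h

theorem s_of_mem_units {u : 𝒢} (h : u ∈ units 𝒢) : s u = u := by
  rw [← r_of_mem_units h, s_r]

theorem mul_of_mem_units_right {α β : 𝒢} (hβ : β ∈ units 𝒢) (h : s α = r β) : mul α β = α := by
  rw [← r_of_mem_units hβ, ← h, mul_s_self]

theorem units_sub (H : Sub 𝒢) : units H.carrier = Subtype.val ⁻¹' units 𝒢 :=
  Set.ext fun _ => Subtype.ext_iff

theorem isotropy_sub (H : Sub 𝒢) : isotropy H.carrier = Subtype.val ⁻¹' isotropy 𝒢 :=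
  Set.ext fun _ => Subtype.ext_iff

theorem Cocycle.isPrincipal_ker_iff {Γ : Type*} [Group Γ] {c : Cocycle 𝒢 Γ} :
    IsPrincipal c.ker.carrier ↔ ∀ γ ∈ isotropy 𝒢, c γ = 1 → γ ∈ units 𝒢 := by
  rw [IsPrincipal, isotropy_sub, units_sub]
  refine ⟨fun h γ e hγ => (Set.ext_iff.1 h ⟨γ, hγ⟩).1 e, fun h => ?_⟩
  refine Set.Subset.antisymm (fun γ e => h γ.1 e γ.2) fun u hu => ?_
  exact (r_of_mem_units hu).trans (s_of_mem_units hu).symm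

end Algebra

section Convolution

variable {𝒢 : Type*} [ArrowGroupoid 𝒢] {K : Type*} [Field K]

theorem conv_eq_mul {f g : 𝒢 → K} {α β γ : 𝒢} (h : s α = r β) (e : mul α β = γ)
    (H : ∀ α' β', s α' = r β' → mul α' β' = γ → f α' ≠ 0 → g β' ≠ 0 → α' = α) :
    conv f g γ = f α * g β := by
  refine finsum_eq_single _ (⟨(α, β), h, e⟩ : {p : 𝒢 × 𝒢 // s p.1 = r p.2 ∧ mul p.1 p.2 = γ}) ?_
  rintro ⟨⟨α', β'⟩, h', e'⟩ hne
  by_contra h0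
  obtain rfl : α' = α := H α' β' h' e' (left_ne_zero_of_mul h0) (right_ne_zero_of_mul h0)
  exact hne (Subtype.ext (Prod.ext rfl ((eq_inv_mul h' e').trans (eq_inv_mul h e).symm)))

theorem exists_of_conv_ne_zero {f g : 𝒢 → K} {γ : 𝒢} (h : conv f g γ ≠ 0) :
    ∃ α β, s α = r β ∧ mul α β = γ ∧ f α ≠ 0 ∧ g β ≠ 0 := by
  obtain ⟨⟨⟨α, β⟩, h1, h2⟩, h3⟩ := not_forall.1 (mt finsum_eq_zero_of_forall_eq_zero h)
  exact ⟨α, β, h1, h2, left_ne_zero_of_mul h3, right_ne_zero_of_mul h3⟩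

theorem conv_zero_left (g : 𝒢 → K) : conv 0 g = 0 := by
  funext γ
  by_contra h
  obtain ⟨α, β, -, -, hα, -⟩ := exists_of_conv_ne_zero h
  exact hα rfl

theorem finite_support_conv {f : 𝒢 → K} {γ : 𝒢} (hf : {α | r α = r γ ∧ f α ≠ 0}.Finite)
    (g : 𝒢 → K) : (Function.support fun p : {p : 𝒢 × 𝒢 // s p.1 = r p.2 ∧ mul p.1 p.2 = γ} =>
      f p.1.1 * g p.1.2).Finite := by
  have hinj : Function.Injective
      fun p : {p : 𝒢 × 𝒢 // s p.1 = r p.2 ∧ mul p.1 p.2 = γ} => p.1.1 := by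
    rintro ⟨⟨α, β⟩, h, e⟩ ⟨⟨α', β'⟩, h', e'⟩ (rfl : α = α')
    exact Subtype.ext (Prod.ext rfl ((eq_inv_mul h e).trans (eq_inv_mul h' e').symm))
  refine (hf.preimage hinj.injOn).subset ?_
  rintro ⟨⟨α, β⟩, h, e⟩ h0
  exact ⟨(r_mul _ _ h).symm.trans (congrArg r e), left_ne_zero_of_mul h0⟩

theorem conv_add_left {f f' : 𝒢 → K} (g : 𝒢 → K)
    (hf : ∀ u, {α | r α = u ∧ f α ≠ 0}.Finite) (hf' : ∀ u, {α | r α = u ∧ f' α ≠ 0}.Finite) :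
    conv (f + f') g = conv f g + conv f' g := by
  funext γ
  simp only [conv, Pi.add_apply, add_mul]
  exact finsum_add_distrib (finite_support_conv (hf _) g) (finite_support_conv (hf' _) g)

theorem conv_of_units_left {f : 𝒢 → K} (hf : ∀ γ ∉ units 𝒢, f γ = 0) (g : 𝒢 → K) (γ : 𝒢) :
    conv f g γ = f (r γ) * g γ := by
  refine conv_eq_mul (s_r γ) (r_mul_self γ) fun α β h e hα _ => ?_
  have hu : α ∈ units 𝒢 := by_contra fun h => hα (hf _ h)
  rw [← e, r_mul _ _ h]
  exact hu.symm

theorem conv_of_units_right {g : 𝒢 → K} (hg : ∀ γ ∉ units 𝒢, g γ = 0) (f : 𝒢 → K) (γ : 𝒢) :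
    conv f g γ = f γ * g (s γ) := by
  refine conv_eq_mul (r_s γ).symm (mul_s_self γ) fun α β h e _ hβ => ?_
  have hu : β ∈ units 𝒢 := by_contra fun h => hβ (hg _ h)
  rw [← e, mul_of_mem_units_right hu h]

theorem conv_of_injOn_left {f : 𝒢 → K} (hi : Set.InjOn r (Function.support f)) (g : 𝒢 → K)
    {α γ : 𝒢} (hα : f α ≠ 0) (e : r α = r γ) : conv f g γ = f α * g (mul (inv α) γ) :=
  conv_eq_mul (s_eq_r_inv_mul e) (mul_inv_mul e) fun _ _ h' e' hα' _ =>
    hi hα' hα (by rw [e, ← e', r_mul _ _ h'])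

variable {W : Set 𝒢}

theorem indicator_eq_zero_of_notMem_units (hW : W ⊆ units 𝒢) :
    ∀ γ ∉ units 𝒢, W.indicator (1 : 𝒢 → K) γ = 0 :=
  fun _ hγ => Set.indicator_of_notMem (fun h => hγ (hW h)) _

theorem indicator_conv (hW : W ⊆ units 𝒢) (f : 𝒢 → K) :
    conv (W.indicator 1) f = (r ⁻¹' W).indicator f := by
  funext γ
  rw [conv_of_units_left (indicator_eq_zero_of_notMem_units hW)]
  by_cases h : r γ ∈ W <;> simp [h]

theorem conv_indicator (hW : W ⊆ units 𝒢) (f : 𝒢 → K) :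
    conv f (W.indicator 1) = (s ⁻¹' W).indicator f := by
  funext γ
  rw [conv_of_units_right (indicator_eq_zero_of_notMem_units hW)]
  by_cases h : s γ ∈ W <;> simp [h]

end Convolution

section Steinberg

variable {K : Type*} [Field K] {𝒢 : Type*} [TopologicalSpace 𝒢]

theorem indicator_mem_steinberg {f : 𝒢 → K} (hf : IsLocallyConstant f) {S : Set 𝒢}
    (hS : IsClopen S) (hc : IsCompact (S ∩ Function.support f)) :
    S.indicator f ∈ steinberg K 𝒢 :=
  ⟨((⟨f, hf⟩ : LocallyConstant 𝒢 K).indicator hS).isLocallyConstant, by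
    rwa [Set.support_indicator]⟩

theorem indicator_mem_steinberg_of_isClopen {f : 𝒢 → K} (hf : f ∈ steinberg K 𝒢) {S : Set 𝒢}
    (hS : IsClopen S) : S.indicator f ∈ steinberg K 𝒢 :=
  indicator_mem_steinberg hf.1 hS (hf.2.inter_left hS.isClosed)

theorem indicator_one_mem_steinberg [T2Space 𝒢] {S : Set 𝒢} (hS : IsOpen S) (hS' : IsCompact S) :
    S.indicator (1 : 𝒢 → K) ∈ steinberg K 𝒢 :=
  indicator_mem_steinberg (IsLocallyConstant.const 1) ⟨hS'.isClosed, hS⟩ (by simpa using hS')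

theorem steinbergOn_mono {W W' : Set 𝒢} (h : W ⊆ W') : steinbergOn K 𝒢 W ≤ steinbergOn K 𝒢 W' :=
  fun _ hf => ⟨hf.1, fun γ hγ => hf.2 γ fun h' => hγ (h h')⟩

end Steinberg

namespace IsAmple

variable {𝒢 : Type*} [TopologicalSpace 𝒢] [ArrowGroupoid 𝒢]

theorem continuous_r (h : IsAmple 𝒢) : Continuous (r : 𝒢 → 𝒢) :=
  continuous_subtype_val.comp h.isLocalHomeomorph_rng.continuous

theorem continuous_s (h : IsAmple 𝒢) : Continuous (s : 𝒢 → 𝒢) := by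
  rw [show (s : 𝒢 → 𝒢) = r ∘ inv from funext fun γ => (r_inv γ).symm]
  exact h.continuous_r.comp h.continuous_inv

theorem isOpen_units (h : IsAmple 𝒢) : IsOpen (units 𝒢) := by
  refine isOpen_iff_mem_nhds.2 fun u hu => ?_
  obtain ⟨e, he, hr⟩ := h.isLocalHomeomorph_rng u
  have h1 : e.source ∈ 𝓝 u := e.open_source.mem_nhds he
  have h2 : r ⁻¹' e.source ∈ 𝓝 u :=
    h.continuous_r.continuousAt.preimage_mem_nhds (by rwa [r_of_mem_units hu])
  filter_upwards [h1, h2] with γ k1 k2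
  refine e.injOn k2 k1 ?_
  rw [← hr]
  exact Subtype.ext (r_r γ)

theorem exists_isCompact_isOpen_subset_units (h : IsAmple 𝒢) {u : units 𝒢} {O : Set (units 𝒢)}
    (hO : IsOpen O) (hu : u ∈ O) : ∃ W, IsCompact W ∧ IsOpen W ∧ u ∈ W ∧ W ⊆ O := by
  have := h.locallyCompact_units
  obtain ⟨C, hC, hCO, hCc⟩ := local_compact_nhds (hO.mem_nhds hu)
  obtain ⟨W, hW, huW, hWC⟩ := h.zeroDimensional_units.mem_nhds_iff.1 hC
  exact ⟨W, hCc.of_isClosed_subset (IsClopen.isClosed hW) hWC, IsClopen.isOpen hW, huW,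
    hWC.trans hCO⟩

theorem exists_isCompact_isOpen_injOn_r (h : IsAmple 𝒢) {γ : 𝒢} {O : Set 𝒢} (hO : IsOpen O)
    (hγ : γ ∈ O) : ∃ B, IsCompact B ∧ IsOpen B ∧ γ ∈ B ∧ B ⊆ O ∧ Set.InjOn r B := by
  obtain ⟨e, he, hr⟩ := h.isLocalHomeomorph_rng γ
  obtain ⟨W, hWc, hW, hγW, hWO⟩ := h.exists_isCompact_isOpen_subset_units
    (e.isOpen_image_of_subset_source (e.open_source.inter hO) Set.inter_subset_left)
    (Set.mem_image_of_mem e ⟨he, hγ⟩)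
  have hWt : W ⊆ e.target :=
    hWO.trans ((Set.image_mono Set.inter_subset_left).trans e.image_source_eq_target.subset)
  have hB : e.symm '' W ⊆ e.source ∩ O := by
    rintro _ ⟨w, hw, rfl⟩
    obtain ⟨x, hx, rfl⟩ := hWO hw
    rwa [e.left_inv hx.1]
  refine ⟨e.symm '' W, hWc.image_of_continuousOn (e.symm.continuousOn.mono hWt),
    e.symm.isOpen_image_of_subset_source hW hWt, ⟨e γ, hγW, e.left_inv he⟩,
    hB.trans Set.inter_subset_right, fun x hx y hy hxy => e.injOn (hB hx).1 (hB hy).1 ?_⟩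
  rw [← hr]
  exact Subtype.ext hxy

theorem exists_isCompact_isOpen_injOn_s (h : IsAmple 𝒢) (γ : 𝒢) :
    ∃ B : Set 𝒢, IsCompact B ∧ IsOpen B ∧ γ ∈ B ∧ Set.InjOn s B := by
  obtain ⟨B, hBc, hBo, hγ, -, hB⟩ :=
    h.exists_isCompact_isOpen_injOn_r isOpen_univ (Set.mem_univ (inv γ))
  have hinv : Function.Involutive (inv : 𝒢 → 𝒢) := ArrowGroupoid.inv_inv
  refine ⟨inv ⁻¹' B, ?_, hBo.preimage h.continuous_inv, hγ, fun α hα β hβ e => ?_⟩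
  · rw [← hinv.image_eq_preimage_symm]
    exact hBc.image h.continuous_inv
  · exact hinv.injective (hB hα hβ (by rwa [r_inv, r_inv]))

theorem eventually_mul_mem (h : IsAmple 𝒢) {α β : 𝒢} (hc : s α = r β) {O : Set 𝒢}
    (hO : IsOpen O) (hm : mul α β ∈ O) :
    ∀ᶠ p : 𝒢 × 𝒢 in 𝓝 (α, β), s p.1 = r p.2 → mul p.1 p.2 ∈ O := by
  obtain ⟨W, hW, e⟩ := isOpen_induced_iff.1 (hO.preimage h.continuous_mul)
  have mem_iff : ∀ p : 𝒢 × 𝒢, s p.1 = r p.2 → (p ∈ W ↔ mul p.1 p.2 ∈ O) := fun p hp =>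
    Set.ext_iff.1 e ⟨p, hp⟩
  filter_upwards [hW.mem_nhds ((mem_iff (α, β) hc).2 hm)] with p hp hp'
  exact (mem_iff p hp').1 hp

theorem eventually_exists_r_eq (h : IsAmple 𝒢) {α γ : 𝒢} (e : r α = r γ) {P : 𝒢 × 𝒢 → Prop}
    (hP : ∀ᶠ p in 𝓝 (α, γ), P p) : ∀ᶠ δ in 𝓝 γ, ∃ α', r α' = r δ ∧ P (α', δ) := by
  rw [nhds_prod_eq] at hP
  obtain ⟨pa, ha, pb, hb, hab⟩ := Filter.eventually_prod_iff.1 hP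
  have hrng : rng '' {α' | pa α'} ∈ 𝓝 (rng γ) := by
    rw [← show rng α = rng γ from Subtype.ext e, ← h.isLocalHomeomorph_rng.map_nhds_eq]
    exact Filter.image_mem_map ha
  filter_upwards [h.isLocalHomeomorph_rng.continuous.continuousAt hrng, hb]
  rintro δ ⟨α', hα', e'⟩ hδ
  exact ⟨α', congrArg Subtype.val e', hab hα' hδ⟩

/-! ### The Steinberg algebra is closed under convolution -/

variable {K : Type*} [Field K]

theorem steinberg_induction (h : IsAmple 𝒢) {P : (𝒢 → K) → Prop} (zero : P 0)
    (add : ∀ f ∈ steinberg K 𝒢, ∀ g ∈ steinberg K 𝒢, P f → P g → P (f + g))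
    (injOn : ∀ f ∈ steinberg K 𝒢, Set.InjOn r (Function.support f) → P f)
    {f : 𝒢 → K} (hf : f ∈ steinberg K 𝒢) : P f := by
  classical
  have := h.hausdorff
  choose B hBc hBo hB _ hBi using
    fun γ : 𝒢 => h.exists_isCompact_isOpen_injOn_r isOpen_univ (Set.mem_univ γ)
  obtain ⟨t, ht⟩ := hf.2.elim_finite_subcover B hBo fun γ _ => Set.mem_iUnion.2 ⟨γ, hB γ⟩
  induction t using Finset.induction_on generalizing f with
  | empty =>
    have : f = 0 := by simpa using ht
    exact this ▸ zero
  | insert i t _ ih =>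
    have hcl : IsClopen (B i) := ⟨(hBc i).isClosed, hBo i⟩
    have h1 := indicator_mem_steinberg_of_isClopen hf hcl
    have h2 := indicator_mem_steinberg_of_isClopen hf hcl.compl
    rw [← Set.indicator_self_add_compl (B i) f]
    refine add _ h1 _ h2 (injOn _ h1 ((hBi i).mono Set.support_indicator_subset)) (ih h2 ?_)
    rw [Set.support_indicator, Set.inter_comm, ← Set.sdiff_eq, Set.sdiff_subset_iff]
    simpa only [Finset.set_biUnion_insert] using ht

theorem finite_setOf_r_eq (h : IsAmple 𝒢) {f : 𝒢 → K} (hf : f ∈ steinberg K 𝒢) (u : 𝒢) :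
    {α | r α = u ∧ f α ≠ 0}.Finite := by
  refine h.steinberg_induction (P := fun f => {α | r α = u ∧ f α ≠ 0}.Finite)
    (by simp) (fun f _ g _ hf hg => ?_) (fun f _ hi => ?_) hf
  · refine (hf.union hg).subset ?_
    rintro α ⟨hα, hne⟩
    exact (Function.support_add f g hne).imp (⟨hα, ·⟩) (⟨hα, ·⟩)
  · exact Set.Subsingleton.finite fun α hα β hβ => hi hα.2 hβ.2 (hα.1.trans hβ.1.symm)

theorem isLocallyConstant_conv (h : IsAmple 𝒢) {f g : 𝒢 → K} (hf : f ∈ steinberg K 𝒢)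
    (hi : Set.InjOn r (Function.support f)) (hg : IsLocallyConstant g) :
    IsLocallyConstant (conv f g) := by
  have := h.hausdorff
  refine (IsLocallyConstant.iff_eventually_eq _).2 fun γ => ?_
  by_cases hγ : r γ ∈ r '' Function.support f
  · obtain ⟨α, hα, e⟩ := hγ
    have hfα : ∀ᶠ p : 𝒢 × 𝒢 in 𝓝 (α, γ), f p.1 = f α :=
      (continuous_fst.tendsto (α, γ)).eventually ((IsLocallyConstant.iff_eventually_eq _).1 hf.1 α)
    have hgγ : ∀ᶠ p : 𝒢 × 𝒢 in 𝓝 (α, γ),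
        s (inv p.1) = r p.2 → mul (inv p.1) p.2 ∈ g ⁻¹' {g (mul (inv α) γ)} :=
      ((h.continuous_inv.prodMap continuous_id).tendsto (α, γ)).eventually
        (h.eventually_mul_mem ((s_inv α).trans e) (hg.isOpen_fiber _) rfl)
    filter_upwards [h.eventually_exists_r_eq e (hfα.and hgγ)]
    rintro δ ⟨α', e', hfα' : f α' = f α, hgδ⟩
    have hgδ' : g (mul (inv α') δ) = g (mul (inv α) γ) := hgδ ((s_inv α').trans e')
    rw [conv_of_injOn_left hi g hα e, conv_of_injOn_left hi g (hfα'.trans_ne hα) e', hfα', hgδ']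
  · have conv_eq_zero : ∀ δ, r δ ∉ r '' Function.support f → conv f g δ = 0 := fun δ hδ => by
      by_contra hne
      obtain ⟨α, β, hc, rfl, hα, -⟩ := exists_of_conv_ne_zero hne
      exact hδ ⟨α, hα, (r_mul _ _ hc).symm⟩
    have hcl : IsClosed (r '' Function.support f) := (hf.2.image h.continuous_r).isClosed
    filter_upwards [(hcl.isOpen_compl.preimage h.continuous_r).mem_nhds hγ] with δ hδ
    rw [conv_eq_zero γ hγ, conv_eq_zero δ hδ]

theorem exists_isCompact_support_conv_subset (h : IsAmple 𝒢) {f g : 𝒢 → K}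
    (hf : f ∈ steinberg K 𝒢) (hg : g ∈ steinberg K 𝒢) :
    ∃ C, IsCompact C ∧ Function.support (conv f g) ⊆ C := by
  have := h.hausdorff
  have hcl : IsClosed {p : 𝒢 × 𝒢 | s p.1 = r p.2} :=
    isClosed_eq (h.continuous_s.comp continuous_fst) (h.continuous_r.comp continuous_snd)
  refine ⟨_, (hcl.isClosedEmbedding_subtypeVal.isCompact_preimage (hf.2.prod hg.2)).image
    h.continuous_mul, fun γ hγ => ?_⟩
  obtain ⟨α, β, hc, e, hα, hβ⟩ := exists_of_conv_ne_zero hγ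
  exact ⟨⟨(α, β), hc⟩, ⟨hα, hβ⟩, e⟩

theorem conv_mem_steinberg (h : IsAmple 𝒢) {f g : 𝒢 → K} (hf : f ∈ steinberg K 𝒢)
    (hg : g ∈ steinberg K 𝒢) : conv f g ∈ steinberg K 𝒢 := by
  have := h.hausdorff
  refine h.steinberg_induction (P := fun f => conv f g ∈ steinberg K 𝒢) ?_
    (fun f hf f' hf' h1 h2 => ?_) (fun f hf hi => ?_) hf
  · rw [conv_zero_left]
    exact zero_mem _
  · rw [conv_add_left _ (h.finite_setOf_r_eq hf) (h.finite_setOf_r_eq hf')]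
    exact add_mem h1 h2
  · have hl := h.isLocallyConstant_conv hf hi hg.1
    obtain ⟨C, hC, hsub⟩ := h.exists_isCompact_support_conv_subset hf hg
    exact ⟨hl, hC.of_isClosed_subset (hl.isClopen_fiber 0).compl.isClosed hsub⟩

end IsAmple

/-! ### Graded ideals -/

section Graded

variable {K : Type*} [Field K] {𝒢 : Type*} [TopologicalSpace 𝒢] [ArrowGroupoid 𝒢]
  {Γ : Type*} [Group Γ] {c : Cocycle 𝒢 Γ}

theorem indicator_mem_homogeneous (hc : IsLocallyConstant c) {f : 𝒢 → K}
    (hf : f ∈ steinberg K 𝒢) (g : Γ) : {γ | c γ = g}.indicator f ∈ homogeneous K c g :=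
  ⟨indicator_mem_steinberg_of_isClopen hf (hc.isClopen_fiber g),
    fun _ h => Set.indicator_of_notMem h f⟩

theorem exists_eq_sum_indicator (hc : IsLocallyConstant c) {f : 𝒢 → K} (hf : f ∈ steinberg K 𝒢) :
    ∃ F : Finset Γ, f = ∑ g ∈ F, {γ | c γ = g}.indicator f := by
  classical
  have hfin : (c '' Function.support f).Finite := by
    let _ : TopologicalSpace Γ := ⊥
    have : DiscreteTopology Γ := ⟨rfl⟩
    exact (hf.2.image hc.continuous).finite_of_discrete
  refine ⟨hfin.toFinset, funext fun γ => ?_⟩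
  simp only [Finset.sum_apply, Set.indicator_apply, Set.mem_ofPred_eq, Finset.sum_ite_eq,
    Set.Finite.mem_toFinset]
  split_ifs with h
  · rfl
  · by_contra h0
    exact h ⟨γ, h0, rfl⟩

theorem iSupIndep_homogeneous : iSupIndep (homogeneous K c) := by
  intro g
  rw [Submodule.disjoint_def]
  intro f hf hf'
  have hle : ⨆ h, ⨆ _ : h ≠ g, homogeneous K c h ≤ steinbergOn K 𝒢 {γ | c γ ≠ g} :=
    iSup₂_le fun h hne => steinbergOn_mono fun γ (hγ : c γ = h) => hγ.trans_ne hne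
  funext γ
  by_cases hγ : c γ = g
  · exact (hle hf').2 γ (not_not.2 hγ)
  · exact hf.2 γ hγ

theorem isGrading_homogeneous (hA : IsAmple 𝒢) (hc : IsLocallyConstant c) :
    IsGrading K (homogeneous K c) where
  independent := iSupIndep_homogeneous
  iSup_eq := by
    refine le_antisymm (iSup_le fun _ _ hf => hf.1) fun f hf => ?_
    obtain ⟨F, hF⟩ := exists_eq_sum_indicator hc hf
    rw [hF]
    exact sum_mem fun g _ => Submodule.mem_iSup_of_mem g (indicator_mem_homogeneous hc hf g)
  conv_mem g h f hf f' hf' := by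
    refine ⟨hA.conv_mem_steinberg hf.1 hf'.1, fun γ hγ => ?_⟩
    by_contra hne
    obtain ⟨α, β, hs, rfl, hα, hβ⟩ := exists_of_conv_ne_zero hne
    have hαg : c α = g := by_contra fun e => hα (hf.2 _ e)
    have hβh : c β = h := by_contra fun e => hβ (hf'.2 _ e)
    exact hγ ((c.map_mul _ _ hs).trans (congrArg₂ _ hαg hβh))

theorem isIdeal_steinbergOn_restrict (hA : IsAmple 𝒢) {U : Set (units 𝒢)} (hU : IsInvariant U) :
    IsIdeal (steinbergOn K 𝒢 (restrict U hU).carrier) where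
  le _ hf := hf.1
  conv_mem_left f hf g hg := by
    refine ⟨hA.conv_mem_steinberg hf hg.1, fun γ hγ => ?_⟩
    by_contra hne
    obtain ⟨α, β, hs, rfl, -, hβ⟩ := exists_of_conv_ne_zero hne
    have hβU : rng β ∈ U := by_contra fun h => hβ (hg.2 β h)
    have hsrc : src (mul α β) = src β := Subtype.ext (s_mul _ _ hs)
    exact hγ ((hU _).2 (hsrc ▸ (hU β).1 hβU))
  conv_mem_right f hf g hg := by
    refine ⟨hA.conv_mem_steinberg hg.1 hf, fun γ hγ => ?_⟩
    by_contra hne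
    obtain ⟨α, β, hs, rfl, hα, -⟩ := exists_of_conv_ne_zero hne
    have hαU : rng α ∈ U := by_contra fun h => hα (hg.2 α h)
    have hrng : rng (mul α β) = rng α := Subtype.ext (r_mul _ _ hs)
    exact hγ (show rng (mul α β) ∈ U from hrng ▸ hαU)

theorem isGradedIdeal_steinbergOn_restrict (hA : IsAmple 𝒢) (hc : IsLocallyConstant c)
    {U : Set (units 𝒢)} (hU : IsInvariant U) :
    IsGradedIdeal (homogeneous K c) (steinbergOn K 𝒢 (restrict U hU).carrier) := by
  refine ⟨isIdeal_steinbergOn_restrict hA hU,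
    le_antisymm (fun f hf => ?_) (iSup_le fun g => inf_le_left)⟩
  obtain ⟨F, hF⟩ := exists_eq_sum_indicator hc hf.1
  rw [hF]
  refine sum_mem fun g _ => Submodule.mem_iSup_of_mem g ?_
  have h := indicator_mem_homogeneous hc hf.1 g
  exact ⟨⟨h.1, fun γ hγ => Set.indicator_apply_eq_zero.2 fun _ => hf.2 γ hγ⟩, h⟩

theorem IsGradedIdeal.indicator_mem {J : Submodule K (𝒢 → K)}
    (hJ : IsGradedIdeal (homogeneous K c) J) {f : 𝒢 → K} (hf : f ∈ J) (g : Γ) :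
    {γ | c γ = g}.indicator f ∈ J := by
  rw [hJ.2] at hf
  induction hf using Submodule.iSup_induction' with
  | mem h f hf =>
    have hfh : Function.support f ⊆ {γ | c γ = h} := fun γ hγ =>
      by_contra fun hne => hγ (hf.2.2 γ hne)
    by_cases e : h = g
    · rw [Set.indicator_eq_self.2 (e ▸ hfh)]
      exact hf.1
    · have h0 : {γ | c γ = g}.indicator f = 0 := Set.indicator_eq_zero'.2 <|
        Set.disjoint_left.2 fun γ hγ hγ' => e ((hfh hγ).symm.trans hγ')
      exact h0 ▸ zero_mem _
  | zero =>
    rw [Set.indicator_zero']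
    exact zero_mem _
  | add x y _ _ hx hy =>
    rw [Set.indicator_add']
    exact add_mem hx hy

end Graded

section UnitSupport

variable {K : Type*} [Field K] {𝒢 : Type*} [TopologicalSpace 𝒢] [ArrowGroupoid 𝒢]
  {J : Submodule K (𝒢 → K)}

/-- The set of the units at which some element of `J` does not vanish; for a graded ideal `J` it
is the open invariant set corresponding to `J`. -/
def unitSupport (J : Submodule K (𝒢 → K)) : Set (units 𝒢) := {u | ∃ f ∈ J, f u.1 ≠ 0}

theorem isOpen_unitSupport (hJ : IsIdeal J) : IsOpen (unitSupport J) := by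
  have : unitSupport J = ⋃ f ∈ J, Subtype.val ⁻¹' (f ⁻¹' {0}ᶜ) := by
    ext u
    simp [unitSupport]
  rw [this]
  exact isOpen_biUnion fun f hf => ((hJ.le hf).1 _).preimage continuous_subtype_val

theorem rng_mem_unitSupport (hA : IsAmple 𝒢) (hJ : IsIdeal J) {f : 𝒢 → K} (hf : f ∈ J) {γ : 𝒢}
    (hγ : f γ ≠ 0) : rng γ ∈ unitSupport J := by
  have := hA.hausdorff
  obtain ⟨B, hBc, hBo, hB, hBi⟩ := hA.exists_isCompact_isOpen_injOn_s (inv γ)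
  refine ⟨_, hJ.conv_mem_right _ (indicator_one_mem_steinberg hBo hBc) f hf, ?_⟩
  have e : conv f (B.indicator 1) (r γ) = f γ := by
    rw [conv_eq_mul (r_inv γ).symm (mul_inv γ), Set.indicator_of_mem hB, Pi.one_apply, mul_one]
    intro α β h e _ hβ
    have hβγ : β = inv γ := hBi (Set.indicator_apply_ne_zero.1 hβ).1 hB <| by
      rw [← s_mul _ _ h, e, s_r, s_inv]
    rw [eq_mul_inv h e, hβγ, ArrowGroupoid.inv_inv, r_mul_self]
  exact e ▸ hγ

theorem isInvariant_unitSupport (hA : IsAmple 𝒢) (hJ : IsIdeal J) :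
    IsInvariant (unitSupport J) := by
  have := hA.hausdorff
  have rng_mem_of_src_mem : ∀ γ : 𝒢, src γ ∈ unitSupport J → rng γ ∈ unitSupport J := by
    rintro γ ⟨f, hf, hne⟩
    obtain ⟨B, hBc, hBo, hB, -, hBi⟩ :=
      hA.exists_isCompact_isOpen_injOn_r isOpen_univ (Set.mem_univ γ)
    refine rng_mem_unitSupport hA hJ
      (hJ.conv_mem_left _ (indicator_one_mem_steinberg hBo hBc) f hf) ?_
    rw [conv_of_injOn_left (hBi.mono Set.support_indicator_subset) f (by simp [hB]) rfl, inv_mul,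
      Set.indicator_of_mem hB, Pi.one_apply, one_mul]
    exact hne
  refine fun γ => ⟨fun h => ?_, rng_mem_of_src_mem γ⟩
  rw [← show rng (inv γ) = src γ from Subtype.ext (r_inv γ)]
  refine rng_mem_of_src_mem (inv γ) ?_
  rwa [show src (inv γ) = rng γ from Subtype.ext (s_inv γ)]

end UnitSupport

section CharacteristicFunctions

variable {K : Type*} [Field K] {𝒢 : Type*} [TopologicalSpace 𝒢] [ArrowGroupoid 𝒢]
  {J : Submodule K (𝒢 → K)}

theorem IsAmple.exists_subset_units_forall_mem_units (hA : IsAmple 𝒢) {S : Set 𝒢}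
    (hS : IsCompact S) (hSu : S ∩ isotropy 𝒢 ⊆ units 𝒢) {u : 𝒢} (hu : u ∈ units 𝒢) {O : Set 𝒢}
    (hO : IsOpen O) (huO : u ∈ O) :
    ∃ W ⊆ units 𝒢, IsCompact W ∧ IsOpen W ∧ u ∈ W ∧ W ⊆ O ∧
      ∀ γ ∈ S, r γ ∈ W → s γ ∈ W → γ ∈ units 𝒢 := by
  have := hA.hausdorff
  have hcl : IsClosed ((fun γ => (r γ, s γ)) '' (S \ units 𝒢)) :=
    ((hS.diff hA.isOpen_units).image (hA.continuous_r.prodMk hA.continuous_s)).isClosed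
  have hmem : (u, u) ∈ ((fun γ => (r γ, s γ)) '' (S \ units 𝒢))ᶜ := by
    rintro ⟨γ, ⟨hγS, hγu⟩, e⟩
    exact hγu (hSu ⟨hγS, (congrArg Prod.fst e).trans (congrArg Prod.snd e).symm⟩)
  obtain ⟨P, Q, hP, hQ, huP, huQ, hPQ⟩ := isOpen_prod_iff.1 hcl.isOpen_compl _ _ hmem
  obtain ⟨W, hWc, hWo, huW, hW, -⟩ := hA.exists_isCompact_isOpen_injOn_r
    (((hP.inter hQ).inter hO).inter hA.isOpen_units) ⟨⟨⟨huP, huQ⟩, huO⟩, hu⟩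
  refine ⟨W, fun w hw => (hW hw).2, hWc, hWo, huW, fun w hw => (hW hw).1.2, fun γ hγ hr hs => ?_⟩
  by_contra hγu
  exact hPQ (Set.mk_mem_prod (hW hr).1.1.1 (hW hs).1.1.2) ⟨γ, ⟨hγ, hγu⟩, rfl⟩

theorem IsIdeal.exists_indicator_one_mem (hA : IsAmple 𝒢) (hJ : IsIdeal J) {f : 𝒢 → K}
    (hf : f ∈ J) (hfu : Function.support f ∩ isotropy 𝒢 ⊆ units 𝒢) {u : 𝒢} (hu : u ∈ units 𝒢)
    (hne : f u ≠ 0) :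
    ∃ W ⊆ units 𝒢, IsOpen W ∧ u ∈ W ∧ W.indicator (1 : 𝒢 → K) ∈ J := by
  have := hA.hausdorff
  obtain ⟨W, hWu, hWc, hWo, huW, hWf, hW⟩ := hA.exists_subset_units_forall_mem_units
    (hJ.le hf).2 hfu hu ((hJ.le hf).1.isOpen_fiber (f u)) rfl
  have h1 := indicator_one_mem_steinberg (K := K) hWo hWc
  have hmem := hJ.conv_mem_left _ h1 _ (hJ.conv_mem_right _ h1 f hf)
  have e : conv (W.indicator 1) (conv f (W.indicator 1)) = f u • W.indicator (1 : 𝒢 → K) := by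
    funext γ
    rw [indicator_conv hWu, conv_indicator hWu, Set.indicator_indicator, Pi.smul_apply,
      smul_eq_mul]
    by_cases hγ : γ ∈ W
    · have hrs : γ ∈ r ⁻¹' W ∩ s ⁻¹' W := by
        rw [Set.mem_inter_iff, Set.mem_preimage, Set.mem_preimage, r_of_mem_units (hWu hγ),
          s_of_mem_units (hWu hγ)]
        exact ⟨hγ, hγ⟩
      rw [Set.indicator_of_mem hrs, Set.indicator_of_mem hγ, Pi.one_apply, mul_one]
      exact hWf hγ
    · rw [Set.indicator_of_notMem hγ, mul_zero, Set.indicator_apply_eq_zero]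
      rintro ⟨hr, hs⟩
      by_contra hfγ
      exact hγ (r_of_mem_units (hW γ hfγ hr hs) ▸ hr)
  refine ⟨W, hWu, hWo, huW, ?_⟩
  rw [← inv_smul_smul₀ hne (W.indicator (1 : 𝒢 → K)), ← e]
  exact J.smul_mem _ hmem

theorem IsIdeal.indicator_union_mem (hJ : IsIdeal J) {W Z : Set 𝒢} (hW : W ⊆ units 𝒢)
    (hZ : Z ⊆ units 𝒢) (hWJ : W.indicator (1 : 𝒢 → K) ∈ J) (hZJ : Z.indicator (1 : 𝒢 → K) ∈ J) :
    (W ∪ Z).indicator (1 : 𝒢 → K) ∈ J := by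
  have hinter : conv (W.indicator 1) (Z.indicator 1) = (W ∩ Z).indicator (1 : 𝒢 → K) := by
    rw [indicator_conv hW, Set.indicator_indicator]
    congr 1
    ext γ
    exact and_congr_left fun hγ => by rw [Set.mem_preimage, r_of_mem_units (hZ hγ)]
  rw [eq_sub_of_add_eq (Set.indicator_union_add_inter (1 : 𝒢 → K) W Z), ← hinter]
  exact sub_mem (add_mem hWJ hZJ) (hJ.conv_mem_left _ (hJ.le hWJ) _ hZJ)

theorem IsIdeal.indicator_biUnion_mem (hJ : IsIdeal J) {ι : Type*} {W : ι → Set 𝒢}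
    (hW : ∀ i, W i ⊆ units 𝒢) (hWJ : ∀ i, (W i).indicator (1 : 𝒢 → K) ∈ J) (t : Finset ι) :
    (⋃ i ∈ t, W i).indicator (1 : 𝒢 → K) ∈ J := by
  classical
  induction t using Finset.induction_on with
  | empty =>
    simp only [Finset.notMem_empty, Set.iUnion_of_empty, Set.iUnion_empty, Set.indicator_empty']
    exact J.zero_mem
  | insert i t _ ih =>
    rw [Finset.set_biUnion_insert]
    exact hJ.indicator_union_mem (hW i) (Set.iUnion₂_subset fun i _ => hW i) (hWJ i) ih

end CharacteristicFunctions

section OrderIso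

variable {K : Type*} [Field K] {𝒢 : Type*} [TopologicalSpace 𝒢] [ArrowGroupoid 𝒢]
  {Γ : Type*} [Group Γ] {c : Cocycle 𝒢 Γ} {J : Submodule K (𝒢 → K)}

theorem IsGradedIdeal.exists_indicator_one_mem (hA : IsAmple 𝒢) (hp : IsPrincipal c.ker.carrier)
    (hJ : IsGradedIdeal (homogeneous K c) J) {u : units 𝒢} (hu : u ∈ unitSupport J) :
    ∃ W ⊆ units 𝒢, IsOpen W ∧ u.1 ∈ W ∧ W.indicator (1 : 𝒢 → K) ∈ J := by
  obtain ⟨f, hf, hne⟩ := hu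
  have hcu : c u.1 = 1 := r_of_mem_units u.2 ▸ c.map_r u.1
  refine hJ.1.exists_indicator_one_mem hA (hJ.indicator_mem hf 1) ?_ u.2 ?_
  · rintro γ ⟨hγ, e⟩
    exact Cocycle.isPrincipal_ker_iff.1 hp _ e (Set.indicator_apply_ne_zero.1 hγ).1
  · rwa [Set.indicator_of_mem (show u.1 ∈ {γ | c γ = 1} from hcu)]

theorem IsGradedIdeal.eq_steinbergOn (hA : IsAmple 𝒢) (hp : IsPrincipal c.ker.carrier)
    (hJ : IsGradedIdeal (homogeneous K c) J) :
    J = steinbergOn K 𝒢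
      (restrict (unitSupport J) (isInvariant_unitSupport hA hJ.1)).carrier := by
  refine le_antisymm (fun f hf => ?_) fun f hf => ?_
  · exact ⟨hJ.1.le hf, fun γ hγ => by_contra fun hne => hγ (rng_mem_unitSupport hA hJ.1 hf hne)⟩
  · choose W hWu hWo hW hWJ using
      fun u : unitSupport J => hJ.exists_indicator_one_mem hA hp u.2
    obtain ⟨t, ht⟩ := (hf.1.2.image hA.continuous_r).elim_finite_subcover W hWo (by
      rintro _ ⟨γ, hγ, rfl⟩
      have hU : rng γ ∈ unitSupport J := by_contra fun h => hγ (hf.2 γ h)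
      exact Set.mem_iUnion.2 ⟨⟨rng γ, hU⟩, hW ⟨rng γ, hU⟩⟩)
    have e : conv ((⋃ i ∈ t, W i).indicator 1) f = f := by
      rw [indicator_conv (Set.iUnion₂_subset fun i _ => hWu i), Set.indicator_eq_self]
      exact Set.image_subset_iff.1 ht
    rw [← e]
    exact hJ.1.conv_mem_right f hf.1 _ (hJ.1.indicator_biUnion_mem hWu hWJ t)

theorem subset_of_steinbergOn_restrict_le (hA : IsAmple 𝒢) {U U' : Set (units 𝒢)} (hUo : IsOpen U)
    (hU : IsInvariant U) (hU' : IsInvariant U')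
    (hle : steinbergOn K 𝒢 (restrict U hU).carrier ≤ steinbergOn K 𝒢 (restrict U' hU').carrier) :
    U ⊆ U' := by
  intro u hu
  have := hA.hausdorff
  have hru : rng u.1 = u := Subtype.ext u.2
  obtain ⟨W, hWc, hWo, huW, hW, -⟩ := hA.exists_isCompact_isOpen_injOn_r
    (hUo.preimage hA.isLocalHomeomorph_rng.continuous)
    (show u.1 ∈ rng ⁻¹' U by rwa [Set.mem_preimage, hru])
  have h := hle (x := W.indicator (1 : 𝒢 → K))
    ⟨indicator_one_mem_steinberg hWo hWc, fun γ hγ =>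
      Set.indicator_of_notMem (fun h => hγ (hW h)) _⟩
  by_contra hu'
  have h0 := h.2 u.1 (fun h => hu' (hru ▸ h))
  rw [Set.indicator_of_mem huW] at h0
  exact one_ne_zero h0

theorem exists_orderIso_gradedIdeals (hA : IsAmple 𝒢) (hc : IsLocallyConstant c)
    (hp : IsPrincipal c.ker.carrier) :
    ∃ Ψ : {U : Set (units 𝒢) // IsOpen U ∧ IsInvariant U} ≃o
        {J : Submodule K (𝒢 → K) // IsGradedIdeal (homogeneous K c) J},
      ∀ U, (Ψ U : Submodule K (𝒢 → K)) = steinbergOn K 𝒢 (restrict U.1 U.2.2).carrier := by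
  let F : {U : Set (units 𝒢) // IsOpen U ∧ IsInvariant U} ↪o
      {J : Submodule K (𝒢 → K) // IsGradedIdeal (homogeneous K c) J} :=
    OrderEmbedding.ofMapLEIff
      (fun U => ⟨_, isGradedIdeal_steinbergOn_restrict hA hc U.2.2⟩)
      fun U U' => ⟨fun h => subset_of_steinbergOn_restrict_le hA U.2.1 U.2.2 U'.2.2 h,
        fun h => steinbergOn_mono fun _ hγ => h hγ⟩
  refine ⟨RelIso.ofSurjective F fun J => ?_, fun U => rfl⟩
  exact ⟨⟨unitSupport J.1, isOpen_unitSupport J.2.1, isInvariant_unitSupport hA J.2.1⟩,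
    Subtype.ext (J.2.eq_steinbergOn hA hp).symm⟩

end OrderIso

theorem IsPrincipal.isStronglyEffective {𝒢 : Type*} [TopologicalSpace 𝒢] [ArrowGroupoid 𝒢]
    (hp : IsPrincipal 𝒢) (ho : IsOpen (units 𝒢)) : IsStronglyEffective 𝒢 := by
  intro C hC _
  rw [IsEffective, isotropy_sub, units_sub, hp]
  exact (ho.preimage continuous_subtype_val).interior_eq

end ArrowGroupoid

/-! ### The groupoid of germs is ample -/

namespace GraphTriple

section

variable {G V E : Type*} [Group G] [MulAction G V] [MulAction G E] {T : GraphTriple G V E}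

namespace InfPath

theorem act_initial (g : G) (ξ : T.InfPath) (n : ℕ) :
    (ξ.initial n).act g = (ξ.act g).initial n :=
  FinPath.ext (ξ.rng_act g).symm (ξ.take_act g n).symm

theorem act_inv_act (g : G) (ξ : T.InfPath) : (ξ.act g).act g⁻¹ = ξ := by
  rw [← act_mul, inv_mul_cancel, act_one]

theorem act_act_inv (g : G) (ξ : T.InfPath) : (ξ.act g⁻¹).act g = ξ := by
  rw [← act_mul, mul_inv_cancel, act_one]

theorem initial_eq_of_le {ξ η : T.InfPath} {m n : ℕ} (hmn : m ≤ n)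
    (h : ξ.initial n = η.initial n) : ξ.initial m = η.initial m := by
  refine FinPath.ext (congrArg FinPath.rng h :) ?_
  change ξ.take m = η.take m
  rw [← ξ.take_take hmn, ← η.take_take hmn]
  exact congrArg (List.take m ∘ FinPath.edges) h

theorem initial_succ_eq_iff {ξ η : T.InfPath} {n : ℕ} :
    ξ.initial (n + 1) = η.initial (n + 1) ↔ ∀ i < n + 1, ξ.edge i = η.edge i := by
  have htake : ξ.take (n + 1) = η.take (n + 1) ↔ ∀ i < n + 1, ξ.edge i = η.edge i := by
    simp only [take, List.map_inj_left, List.mem_range]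
  rw [← htake, FinPath.ext_iff]
  exact and_iff_right_of_imp fun h => congrArg T.r (htake.1 h 0 n.succ_pos)

theorem finite_image_edge (hr : ∀ v, (T.r ⁻¹' {v}).Finite) (v : V)
    (n : ℕ) : ((fun ξ : T.InfPath => ξ.edge n) '' {ξ | ξ.rng = v}).Finite := by
  induction n with
  | zero => exact (hr v).subset (Set.image_subset_iff.2 fun ξ hξ => hξ)
  | succ n ih =>
    refine (ih.biUnion fun a _ => hr (T.s a)).subset ?_
    rintro _ ⟨ξ, hξ, rfl⟩
    exact Set.mem_biUnion ⟨ξ, hξ, rfl⟩ (ξ.valid n).symm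

end InfPath

namespace FinPath

theorem append_initial (α : T.FinPath) (ξ : T.InfPath) (h : α.src = ξ.rng) (n : ℕ) :
    α.append (ξ.initial n) h = (α.prepend ξ h).initial (α.length + n) :=
  FinPath.ext (α.rng_prepend ξ h).symm (α.take_prepend ξ h n).symm

theorem initial_prepend (α : T.FinPath) (ξ : T.InfPath) (h : α.src = ξ.rng) :
    (α.prepend ξ h).initial α.length = α :=
  (α.append_initial ξ h 0).symm.trans (FinPath.ext rfl (List.append_nil _))

end FinPath

namespace Triple

/-- The triple `(α (gε), φ(g, ε), βε)`, that is, the product of `(α, g, β)` and the idempotent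
of `βε`. Its germs are the germs of `(α, g, β)` at the paths that begin with `βε`. -/
def extend (x : T.Triple) (ε : T.FinPath) (h : x.β.src = ε.rng) : T.Triple where
  α := x.α.append (ε.act x.g) (mul_aux₃ x ε h)
  g := ε.coc x.g
  β := x.β.append ε h
  src_eq := by rw [FinPath.src_append, FinPath.src_append, FinPath.src_act, FinPath.coc_smul]

theorem src_extend (x : T.Triple) (ε : T.FinPath) (h : x.β.src = ε.rng) :
    (x.extend ε h).β.src = ε.src := FinPath.src_append _ _ h

/-- The product `(α, gh, γ)` of `(α, g, β)` and `(β, h, γ)`. -/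
def comp (x y : T.Triple) (h : x.β = y.α) : T.Triple :=
  ⟨x.α, x.g * y.g, y.β, by rw [x.src_eq, h, y.src_eq, mul_smul]⟩

theorem extend_comp_extend (x y : T.Triple) (h : x.β = y.α) (ε : T.FinPath)
    (k : y.β.src = ε.rng) (l : x.β.src = (ε.act y.g).rng)
    (m : (x.extend (ε.act y.g) l).β = (y.extend ε k).α) :
    (x.extend (ε.act y.g) l).comp (y.extend ε k) m = (x.comp y h).extend ε k := by
  refine Triple.ext (FinPath.ext rfl ?_) (T.cocList_mul _ _ _).symm rfl
  change x.α.edges ++ T.actList x.g (T.actList y.g ε.edges) =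
    x.α.edges ++ T.actList (x.g * y.g) ε.edges
  rw [actList_mul]

theorem mul_of_eq (x y : T.Triple) (h : x.β = y.α) : x.mul y = some (x.comp y h) := by
  have hα : y.α.src = (FinPath.ofVertex (T := T) y.α.src).rng := rfl
  rw [mul_of_left x y (FinPath.ofVertex y.α.src) hα
    (h.trans (FinPath.ext rfl (List.append_nil _).symm))]
  congr 1
  refine Triple.ext rfl ?_ (FinPath.ext rfl (List.append_nil _))
  simp [comp, FinPath.coc, FinPath.ofVertex, cocList]

end Triple

namespace Germ

open ArrowGroupoid

theorem mk_extend (x : T.Triple) (ε : T.FinPath) (h : x.β.src = ε.rng) (ξ : T.InfPath)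
    (k : ε.src = ξ.rng) :
    mk ⟨x.extend ε h, ξ, (x.src_extend ε h).trans k⟩ =
      mk ⟨x, ε.prepend ξ k, h.trans (ε.rng_prepend ξ k).symm⟩ := by
  have hε : (x.extend ε h).β.src = ξ.rng := (x.src_extend ε h).trans k
  refine mk_eq_mk.2 ((PreGerm.rel_iff _ _).2 ⟨?_, ?_, ?_⟩)
  · exact FinPath.prepend_append x.β ε ξ h hε
  · refine (FinPath.prepend_append x.α (ε.act x.g) (ξ.act (ε.coc x.g)) (x.mul_aux₃ ε h)
      (PreGerm.act_eq ⟨x.extend ε h, ξ, hε⟩)).trans ?_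
    simp only [PreGerm.target, FinPath.act_prepend]
  · refine (PreGerm.lag_eq_iff _ _).2 ⟨?_, 0, fun n _ => ?_⟩
    · simp only [Triple.extend, FinPath.length_append, FinPath.length_act]
      omega
    · simp only [Triple.extend, FinPath.length_append, FinPath.length_act]
      rw [add_comm x.α.length ε.length, add_assoc, FinPath.Phi_prepend]

/-- The set of all germs `[α, g, β; βξ]` of the triple `(α, g, β)`. It equals `Theta x x.β`, and
the source and range maps are injective on it. -/
def bisection (x : T.Triple) : Set T.Germ := {γ | ∃ ξ h, γ = mk ⟨x, ξ, h⟩}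

theorem bisection_extend_subset (x : T.Triple) (ε : T.FinPath) (h : x.β.src = ε.rng) :
    bisection (x.extend ε h) ⊆ bisection x := by
  rintro _ ⟨ξ, k, rfl⟩
  exact ⟨_, _, mk_extend x ε h ξ ((x.src_extend ε h).symm.trans k)⟩

theorem mk_extend_initial (p : T.PreGerm) (n : ℕ) :
    mk ⟨p.x.extend (p.ξ.initial n) p.src_eq, p.ξ.drop n,
      (p.x.src_extend _ p.src_eq).trans (p.ξ.src_initial n)⟩ = mk p := by
  refine (mk_extend p.x (p.ξ.initial n) p.src_eq _ (p.ξ.src_initial n)).trans ?_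
  congr 1
  exact PreGerm.ext rfl (p.ξ.initial_prepend_drop n)

theorem mem_bisection_extend (p : T.PreGerm) (n : ℕ) :
    mk p ∈ bisection (p.x.extend (p.ξ.initial n) p.src_eq) :=
  ⟨_, _, (mk_extend_initial p n).symm⟩

theorem extend_initial_α (p : T.PreGerm) (n : ℕ) :
    (p.x.extend (p.ξ.initial n) p.src_eq).α = p.target.initial (p.x.α.length + n) := by
  rw [PreGerm.target, ← FinPath.append_initial]
  simp only [Triple.extend, InfPath.act_initial]

theorem extend_initial_β (p : T.PreGerm) (n : ℕ) :
    (p.x.extend (p.ξ.initial n) p.src_eq).β = p.base.initial (p.x.β.length + n) :=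
  FinPath.append_initial _ _ _ _

theorem initial_srcPath_of_mem_bisection_extend {p : T.PreGerm} {n : ℕ} {γ : T.Germ}
    (h : γ ∈ bisection (p.x.extend (p.ξ.initial n) p.src_eq)) :
    γ.srcPath.initial n = p.base.initial n := by
  obtain ⟨ξ, k, rfl⟩ := h
  have hlen : (p.x.extend (p.ξ.initial n) p.src_eq).β.length = p.x.β.length + n := by
    rw [extend_initial_β, InfPath.length_initial]
  refine InfPath.initial_eq_of_le (Nat.le_add_left n p.x.β.length) ?_
  rw [← extend_initial_β, ← hlen]
  exact FinPath.initial_prepend _ ξ k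

theorem exists_extend_eq {p q : T.PreGerm} (h : mk p = mk q) :
    ∃ m n, p.x.extend (p.ξ.initial m) p.src_eq = q.x.extend (q.ξ.initial n) q.src_eq := by
  obtain ⟨hbase, htarget, hlag⟩ := (PreGerm.rel_iff p q).1 (mk_eq_mk.1 h)
  obtain ⟨hl, N, hN⟩ := (PreGerm.lag_eq_iff p q).1 hlag
  refine ⟨q.x.α.length + N, p.x.α.length + N, Triple.ext ?_ (hN N le_rfl) ?_⟩
  · rw [extend_initial_α, extend_initial_α, htarget, Nat.add_left_comm]
  · rw [extend_initial_β, extend_initial_β, hbase]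
    congr 1
    omega

theorem mem_cylinder_iff {δ : T.FinPath} {η : T.InfPath} :
    η ∈ cylinder δ ↔ η.initial δ.length = δ := by
  constructor
  · rintro ⟨ξ, h, rfl⟩
    exact δ.initial_prepend ξ h
  · intro h
    refine ⟨η.drop δ.length, (congrArg FinPath.src h).symm.trans (η.src_initial _), ?_⟩
    conv_lhs => rw [← η.initial_prepend_drop δ.length]
    congr 1

theorem Theta_eq (x : T.Triple) (δ : T.FinPath) :
    Theta x δ = bisection x ∩ srcPath ⁻¹' cylinder δ := by
  ext γ
  constructor
  · rintro ⟨ξ, h, hδ, rfl⟩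
    exact ⟨⟨ξ, h, rfl⟩, hδ⟩
  · rintro ⟨⟨ξ, h, rfl⟩, hδ⟩
    exact ⟨ξ, h, hδ, rfl⟩

theorem Theta_self (x : T.Triple) : Theta x x.β = bisection x := by
  rw [Theta_eq, Set.inter_eq_left]
  rintro _ ⟨ξ, h, rfl⟩
  exact ⟨ξ, h, rfl⟩

theorem exists_bisection_subset_Theta {x : T.Triple} {δ : T.FinPath} {γ : T.Germ}
    (hγ : γ ∈ Theta x δ) : ∃ y, γ ∈ bisection y ∧ bisection y ⊆ Theta x δ := by
  obtain ⟨ξ, h, hδ, rfl⟩ := hγ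
  refine ⟨_, mem_bisection_extend ⟨x, ξ, h⟩ δ.length, fun γ hγ => ?_⟩
  rw [Theta_eq]
  refine ⟨bisection_extend_subset _ _ _ hγ, mem_cylinder_iff.2 ?_⟩
  exact (initial_srcPath_of_mem_bisection_extend hγ).trans (mem_cylinder_iff.1 hδ)

theorem isTopologicalBasis_bisection :
    TopologicalSpace.IsTopologicalBasis (Set.range (bisection : T.Triple → Set T.Germ)) where
  exists_subset_inter := by
    rintro _ ⟨x, rfl⟩ _ ⟨y, rfl⟩ _ ⟨⟨ξ, h, rfl⟩, ⟨η, k, e⟩⟩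
    obtain ⟨m, n, hxy⟩ := exists_extend_eq e
    refine ⟨_, ⟨_, rfl⟩, mem_bisection_extend ⟨x, ξ, h⟩ m,
      Set.subset_inter (bisection_extend_subset _ _ _) ?_⟩
    rw [hxy]
    exact bisection_extend_subset _ _ _
  sUnion_eq := by
    refine Set.eq_univ_of_forall fun γ => ?_
    induction γ using Quotient.ind with
    | _ p => exact ⟨_, ⟨p.x, rfl⟩, p.ξ, p.src_eq, rfl⟩
  eq_generateFrom := by
    refine le_antisymm (le_generateFrom ?_) (le_generateFrom ?_)
    · rintro _ ⟨x, rfl⟩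
      exact TopologicalSpace.isOpen_generateFrom_of_mem ⟨x, x.β, (Theta_self x).symm⟩
    · rintro _ ⟨x, δ, rfl⟩
      have e : Theta x δ = ⋃₀ {W ∈ Set.range bisection | W ⊆ Theta x δ} := by
        refine Set.Subset.antisymm (fun γ hγ => ?_) (Set.sUnion_subset fun W hW => hW.2)
        obtain ⟨y, hγy, hy⟩ := exists_bisection_subset_Theta hγ
        exact ⟨_, ⟨⟨y, rfl⟩, hy⟩, hγy⟩
      rw [e]
      exact .sUnion _ fun W hW => .basic W hW.1

theorem isOpen_bisection (x : T.Triple) : IsOpen (bisection x) :=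
  isTopologicalBasis_bisection.isOpen ⟨x, rfl⟩

theorem exists_bisection_extend_subset (p : T.PreGerm) {O : Set T.Germ} (hO : IsOpen O)
    (hp : mk p ∈ O) : ∃ n, bisection (p.x.extend (p.ξ.initial n) p.src_eq) ⊆ O := by
  obtain ⟨_, ⟨y, rfl⟩, ⟨ξ, h, e⟩, hy⟩ :=
    isTopologicalBasis_bisection.exists_subset_of_mem_open hp hO
  obtain ⟨m, n, hxy⟩ := exists_extend_eq e
  refine ⟨m, ?_⟩
  rw [hxy]
  exact (bisection_extend_subset _ _ _).trans hy

section Inversion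

theorem inv_mem_bisection_star {x : T.Triple} {γ : T.Germ} (h : γ ∈ bisection x) :
    ArrowGroupoid.inv γ ∈ bisection x.star := by
  obtain ⟨ξ, h, rfl⟩ := h
  exact ⟨_, PreGerm.act_eq ⟨x, ξ, h⟩, rfl⟩

theorem preimage_inv_bisection (x : T.Triple) :
    ArrowGroupoid.inv ⁻¹' bisection x = bisection x.star := by
  ext γ
  refine ⟨fun h => ArrowGroupoid.inv_inv γ ▸ inv_mem_bisection_star h, fun h => ?_⟩
  have hstar : x.star.star = x := Triple.ext rfl (inv_inv x.g) rfl
  exact hstar ▸ inv_mem_bisection_star h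

theorem continuous_inv : Continuous (ArrowGroupoid.inv : T.Germ → T.Germ) := by
  refine isTopologicalBasis_bisection.continuous_iff.2 ?_
  rintro _ ⟨x, rfl⟩
  rw [preimage_inv_bisection]
  exact isOpen_bisection _

end Inversion

section Units

theorem isLocallyConstant_initial_srcPath (n : ℕ) :
    IsLocallyConstant fun γ : T.Germ => γ.srcPath.initial n := by
  refine (IsLocallyConstant.iff_eventually_eq _).2 fun γ => ?_
  induction γ using Quotient.ind with
  | _ p =>
    filter_upwards [(isOpen_bisection _).mem_nhds (mem_bisection_extend p n)] with δ hδ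
    exact initial_srcPath_of_mem_bisection_extend hδ

theorem isLocallyConstant_rng_srcPath : IsLocallyConstant fun γ : T.Germ => γ.srcPath.rng :=
  (isLocallyConstant_initial_srcPath 0).comp (FinPath.rng (T := T))

theorem isLocallyConstant_edge_srcPath (i : ℕ) :
    IsLocallyConstant fun γ : T.Germ => γ.srcPath.edge i := by
  refine (IsLocallyConstant.iff_eventually_eq _).2 fun γ => ?_
  filter_upwards [(isLocallyConstant_initial_srcPath (i + 1)).eventually_eq γ] with δ hδ
  exact InfPath.initial_succ_eq_iff.1 hδ i i.lt_succ_self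

theorem isLocallyConstant_edge_rngPath (i : ℕ) :
    IsLocallyConstant fun γ : T.Germ => γ.rngPath.edge i := by
  have h : (fun γ : T.Germ => γ.rngPath.edge i) =
      (fun γ => γ.srcPath.edge i) ∘ ArrowGroupoid.inv :=
    funext fun γ => congrArg (InfPath.edge · i) (srcPath_inv γ).symm
  exact h ▸ (isLocallyConstant_edge_srcPath i).comp_continuous continuous_inv

theorem unit_srcPath {u : T.Germ} (h : u ∈ units T.Germ) : unit u.srcPath = u :=
  s_of_mem_units h

theorem unit_mem_units (η : T.InfPath) : unit η ∈ units T.Germ :=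
  congrArg unit (rngPath_unit η)

theorem exists_unit_mem_of_isOpen {η : T.InfPath} {O : Set T.Germ} (hO : IsOpen O)
    (h : unit η ∈ O) : ∃ n, ∀ ζ : T.InfPath, ζ.initial n = η.initial n → unit ζ ∈ O := by
  obtain ⟨n, hn⟩ := exists_bisection_extend_subset (PreGerm.unit η) hO h
  refine ⟨n, fun ζ hζ => hn ?_⟩
  have hrng : ζ.rng = η.rng := congrArg FinPath.rng hζ
  have e : (PreGerm.unit ζ).x.extend (ζ.initial n) (PreGerm.unit ζ).src_eq =
      (PreGerm.unit η).x.extend (η.initial n) (PreGerm.unit η).src_eq := by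
    simp only [PreGerm.unit, hrng, hζ]
  exact e ▸ mem_bisection_extend (PreGerm.unit ζ) n

theorem injective_edge_srcPath_units :
    Function.Injective fun u : units T.Germ => u.1.srcPath.edge := by
  intro u v h
  apply Subtype.ext
  rw [← unit_srcPath u.2, ← unit_srcPath v.2]
  exact congrArg unit (InfPath.ext h)

theorem range_edge_srcPath_units :
    (Set.range fun u : units T.Germ => u.1.srcPath.edge) =
      ⋂ n, {f : ℕ → E | T.s (f n) = T.r (f (n + 1))} := by
  ext f
  simp only [Set.mem_range, Set.mem_iInter, Set.mem_ofPred_eq]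
  constructor
  · rintro ⟨u, rfl⟩ n
    exact u.1.srcPath.valid n
  · intro hf
    exact ⟨⟨unit ⟨f, hf⟩, unit_mem_units _⟩, congrArg InfPath.edge (srcPath_unit _)⟩

variable [TopologicalSpace E] [DiscreteTopology E]

theorem isInducing_edge_srcPath_units :
    IsInducing fun u : units T.Germ => u.1.srcPath.edge := by
  refine isInducing_iff_nhds.2 fun u => le_antisymm ?_ fun O hO => ?_
  · exact (continuous_pi fun i => (isLocallyConstant_edge_srcPath i).continuous.comp
      continuous_subtype_val).continuousAt.tendsto.le_comap
  · obtain ⟨O', hO', hO'O⟩ := mem_nhds_subtype _ _ _ |>.1 hO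
    obtain ⟨W, hW, hWo, hu⟩ := mem_nhds_iff.1 hO'
    rw [← unit_srcPath u.2] at hu
    obtain ⟨n, hn⟩ := exists_unit_mem_of_isOpen hWo hu
    have hnhds : {f : ℕ → E | ∀ i < n + 1, f i = u.1.srcPath.edge i} ∈ 𝓝 u.1.srcPath.edge := by
      refine (Set.finite_lt_nat (n + 1)).eventually_all.2 fun i _ => ?_
      exact (continuous_apply i).continuousAt.eventually_mem (isOpen_discrete {_} |>.mem_nhds rfl)
    refine ⟨_, hnhds, fun v hv => hO'O (hW ?_)⟩
    rw [← unit_srcPath v.2]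
    exact hn _ (InfPath.initial_eq_of_le n.le_succ (InfPath.initial_succ_eq_iff.2 hv))

theorem isClosedEmbedding_edge_srcPath_units :
    IsClosedEmbedding fun u : units T.Germ => u.1.srcPath.edge := by
  refine ⟨⟨isInducing_edge_srcPath_units, injective_edge_srcPath_units⟩, ?_⟩
  rw [range_edge_srcPath_units]
  refine isClosed_iInter fun n => ?_
  exact IsClosed.preimage (f := fun f : ℕ → E => (f n, f (n + 1)))
    ((continuous_apply n).prodMk (continuous_apply (n + 1)))
    (isClosed_discrete {p | T.s p.1 = T.r p.2})

end Units

section Compactness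

theorem isCompact_setOf_rng_srcPath_eq (hr : ∀ v, (T.r ⁻¹' {v}).Finite) (v : V) :
    IsCompact {u : units T.Germ | u.1.srcPath.rng = v} := by
  let _ : TopologicalSpace E := ⊥
  have : DiscreteTopology E := ⟨rfl⟩
  have hclosed : IsClosed {u : units T.Germ | u.1.srcPath.rng = v} :=
    (isLocallyConstant_rng_srcPath.isClosed_fiber v).preimage continuous_subtype_val
  refine (isClosedEmbedding_edge_srcPath_units.isCompact_preimage (isCompact_univ_pi fun n =>
    (InfPath.finite_image_edge hr v n).isCompact)).of_isClosed_subset hclosed ?_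
  exact fun u hu n _ => ⟨u.1.srcPath, hu, rfl⟩

theorem weaklyLocallyCompactSpace_units (hr : ∀ v, (T.r ⁻¹' {v}).Finite) :
    WeaklyLocallyCompactSpace (units T.Germ) where
  exists_compact_mem_nhds u := ⟨_, isCompact_setOf_rng_srcPath_eq hr u.1.srcPath.rng,
    ((isLocallyConstant_rng_srcPath.isOpen_fiber _).preimage continuous_subtype_val).mem_nhds rfl⟩

theorem totallyDisconnectedSpace_units : TotallyDisconnectedSpace (units T.Germ) := by
  let _ : TopologicalSpace E := ⊥
  have : DiscreteTopology E := ⟨rfl⟩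
  exact isClosedEmbedding_edge_srcPath_units.isEmbedding.isTotallyDisconnected_range.1
    (isTotallyDisconnected_of_totallyDisconnectedSpace _)

end Compactness

section Range

theorem continuous_rng : Continuous (rng : T.Germ → units T.Germ) := by
  let _ : TopologicalSpace E := ⊥
  have : DiscreteTopology E := ⟨rfl⟩
  refine isInducing_edge_srcPath_units.continuous_iff.2 (continuous_pi fun i => ?_)
  have h : (fun γ : T.Germ => (rng γ).1.srcPath.edge i) = fun γ => γ.rngPath.edge i :=
    funext fun γ => congrArg (InfPath.edge · i) (srcPath_unit _)
  exact h ▸ (isLocallyConstant_edge_rngPath i).continuous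

theorem unit_prepend (α : T.FinPath) (ξ : T.InfPath) (h : α.src = ξ.rng) :
    unit (α.prepend ξ h) = mk ⟨Triple.ofPair α α rfl, ξ, h⟩ := by
  refine ext' (srcPath_unit _) ((rngPath_unit _).trans ?_) ((lagFun_unit _).trans ?_)
  · change _ = α.prepend (ξ.act 1) (by rw [ξ.act_one, h])
    congr 1
    exact ξ.act_one.symm
  · refine SemidirectProduct.ext ?_ ?_
    · change 1 = coronaAction G _ (QuotientGroup.mk (ξ.Phi 1))
      rw [InfPath.Phi_one, QuotientGroup.mk_one, map_one]
    · exact (congrArg Multiplicative.ofAdd (sub_self _)).symm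

theorem image_rng_bisection (x : T.Triple) :
    rng '' bisection x = Subtype.val ⁻¹' bisection (Triple.ofPair x.α x.α rfl) := by
  ext u
  constructor
  · rintro ⟨_, ⟨ξ, h, rfl⟩, rfl⟩
    exact ⟨_, _, unit_prepend _ _ (PreGerm.act_eq ⟨x, ξ, h⟩)⟩
  · rintro ⟨ξ, h, e⟩
    have hα : x.α.src = ξ.rng := h
    have hξ : x.β.src = (ξ.act x.g⁻¹).rng := by
      rw [InfPath.rng_act, ← hα, x.src_eq, inv_smul_smul]
    refine ⟨_, ⟨ξ.act x.g⁻¹, hξ, rfl⟩, Subtype.ext ?_⟩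
    refine (congrArg unit ?_).trans ((unit_prepend x.α ξ h).trans e.symm)
    simp only [rngPath, mk, Quotient.lift_mk, PreGerm.target, InfPath.act_act_inv]

theorem isOpenMap_rng : IsOpenMap (rng : T.Germ → units T.Germ) := by
  refine isTopologicalBasis_bisection.isOpenMap_iff.2 ?_
  rintro _ ⟨x, rfl⟩
  rw [image_rng_bisection]
  exact (isOpen_bisection _).preimage continuous_subtype_val

theorem injOn_rng_bisection (x : T.Triple) : Set.InjOn rng (bisection x) := by
  rintro _ ⟨ξ, h, rfl⟩ _ ⟨η, k, rfl⟩ e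
  have hact : ξ.act x.g = η.act x.g :=
    FinPath.prepend_inj (h := PreGerm.act_eq ⟨x, ξ, h⟩) (h' := PreGerm.act_eq ⟨x, η, k⟩)
      (unit_inj (congrArg Subtype.val e))
  obtain rfl : ξ = η := by rw [← ξ.act_inv_act x.g, hact, η.act_inv_act x.g]
  rfl

theorem isLocalHomeomorph_rng : IsLocalHomeomorph (rng : T.Germ → units T.Germ) := by
  refine isLocalHomeomorph_iff_isOpenEmbedding_restrict.2 fun γ => ?_
  obtain ⟨_, ⟨x, rfl⟩, hγ, -⟩ :=
    isTopologicalBasis_bisection.exists_subset_of_mem_open (Set.mem_univ γ) isOpen_univ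
  exact ⟨bisection x, (isOpen_bisection x).mem_nhds hγ,
    .of_continuous_injective_isOpenMap (continuous_rng.comp continuous_subtype_val)
      (injOn_rng_bisection x).injective (isOpenMap_rng.domRestrict (isOpen_bisection x))⟩

end Range

section Multiplication

theorem mul_mk (x y : T.Triple) (h : x.β = y.α) (ξ : T.InfPath) (k : y.β.src = ξ.rng)
    (l : x.β.src = (ξ.act y.g).rng) :
    ArrowGroupoid.mul (mk ⟨x, ξ.act y.g, l⟩) (mk ⟨y, ξ, k⟩) = mk ⟨x.comp y h, ξ, k⟩ := by
  refine IsMul.mul_eq ⟨_, _, rfl, rfl, ?_, Triple.mul_of_eq x y h, rfl⟩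
  simp only [PreGerm.base, PreGerm.target, h]

theorem act_eq_of_composable {x y : T.Triple} (h : x.β = y.α) {ξ η : T.InfPath}
    {l : x.β.src = η.rng} {k : y.β.src = ξ.rng}
    (e : ArrowGroupoid.s (mk ⟨x, η, l⟩) = ArrowGroupoid.r (mk ⟨y, ξ, k⟩)) : η = ξ.act y.g := by
  have hpath : x.β.prepend η l = y.α.prepend (ξ.act y.g) (PreGerm.act_eq ⟨y, ξ, k⟩) := unit_inj e
  obtain ⟨α, g, β, hx⟩ := x
  obtain rfl : β = y.α := h
  exact FinPath.prepend_inj hpath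

theorem exists_composable {γ δ : T.Germ} (h : ArrowGroupoid.s γ = ArrowGroupoid.r δ) :
    ∃ (x y : T.Triple) (ξ : T.InfPath) (l : x.β.src = (ξ.act y.g).rng) (k : y.β.src = ξ.rng),
      x.β = y.α ∧ γ = mk ⟨x, ξ.act y.g, l⟩ ∧ δ = mk ⟨y, ξ, k⟩ := by
  induction γ using Quotient.ind with
  | _ p =>
    induction δ using Quotient.ind with
    | _ q =>
      have hpath : p.base = q.target := unit_inj h
      have hxy : (p.x.extend (p.ξ.initial q.x.α.length) p.src_eq).β =
          (q.x.extend (q.ξ.initial p.x.β.length) q.src_eq).α := by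
        rw [extend_initial_α, extend_initial_β, hpath, add_comm]
      have hp := mk_extend_initial p q.x.α.length
      have hq := mk_extend_initial q p.x.β.length
      change ArrowGroupoid.s (mk p) = ArrowGroupoid.r (mk q) at h
      rw [← hp, ← hq] at h
      have hξ := act_eq_of_composable hxy h
      refine ⟨_, _, _, ?_, _, hxy, ?_, hq.symm⟩
      · rw [← hξ]
        exact (p.x.src_extend _ p.src_eq).trans (p.ξ.src_initial _)
      · refine hp.symm.trans ?_
        congr 1
        exact PreGerm.ext rfl hξ

theorem mul_mem_bisection_comp {x y : T.Triple} (h : x.β = y.α) {γ δ : T.Germ}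
    (hγ : γ ∈ bisection x) (hδ : δ ∈ bisection y) (e : ArrowGroupoid.s γ = ArrowGroupoid.r δ) :
    ArrowGroupoid.mul γ δ ∈ bisection (x.comp y h) := by
  obtain ⟨η, l, rfl⟩ := hγ
  obtain ⟨ξ, k, rfl⟩ := hδ
  obtain rfl := act_eq_of_composable h e
  exact ⟨ξ, k, mul_mk x y h ξ k l⟩

theorem continuous_mul : Continuous fun p : {p : T.Germ × T.Germ //
    ArrowGroupoid.s p.1 = ArrowGroupoid.r p.2} => ArrowGroupoid.mul p.1.1 p.1.2 := by
  refine continuous_def.2 fun O hO => isOpen_iff_mem_nhds.2 ?_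
  rintro ⟨⟨γ, δ⟩, hγδ⟩ hm
  obtain ⟨x, y, ξ, l, k, h, rfl, rfl⟩ := exists_composable hγδ
  rw [Set.mem_preimage, mul_mk x y h ξ k l] at hm
  obtain ⟨n, hn⟩ := exists_bisection_extend_subset _ hO hm
  have hl : x.β.src = ((ξ.initial n).act y.g).rng := l.trans (InfPath.rng_act _ _)
  have hk : y.β.src = (ξ.initial n).rng := k
  have hγ : bisection (x.extend ((ξ.initial n).act y.g) hl) ∈ 𝓝 (mk ⟨x, ξ.act y.g, l⟩) := by
    refine (isOpen_bisection _).mem_nhds ?_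
    simp only [InfPath.act_initial]
    exact mem_bisection_extend ⟨x, ξ.act y.g, l⟩ n
  have hδ : bisection (y.extend (ξ.initial n) hk) ∈ 𝓝 (mk ⟨y, ξ, k⟩) :=
    (isOpen_bisection _).mem_nhds (mem_bisection_extend ⟨y, ξ, k⟩ n)
  have hβα : (x.extend ((ξ.initial n).act y.g) hl).β = (y.extend (ξ.initial n) hk).α := by
    simp only [Triple.extend, h]
  filter_upwards [continuous_subtype_val.continuousAt (prod_mem_nhds hγ hδ)] with p hp
  have hmul := mul_mem_bisection_comp hβα hp.1 hp.2 p.2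
  rw [Triple.extend_comp_extend x y h _ hk hl] at hmul
  exact hn hmul

end Multiplication

theorem isAmple (hr : ∀ v, (T.r ⁻¹' {v}).Finite) (hT : T2Space T.Germ) : IsAmple T.Germ := by
  have := weaklyLocallyCompactSpace_units hr
  have := totallyDisconnectedSpace_units (T := T)
  exact {
    continuous_inv := continuous_inv
    continuous_mul := continuous_mul
    hausdorff := hT
    locallyCompact_units := inferInstance
    isLocalHomeomorph_rng := isLocalHomeomorph_rng
    zeroDimensional_units := loc_compact_Haus_tot_disc_of_zero_dim }

end Germ

/-! ### The kernel of the lag cocycle -/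

theorem PreGerm.lag_eq_one_iff (p : T.PreGerm) :
    p.lag = 1 ↔ p.x.α.length = p.x.β.length ∧ ∃ N, ∀ n ≥ N, p.ξ.Phi p.x.g n = 1 := by
  rw [← PreGerm.lag_unit p.base, PreGerm.lag_eq_iff]
  simp [PreGerm.unit, Triple.ofPair, FinPath.ofVertex, FinPath.length, InfPath.Phi_one]

variable (T) in
theorem isPrincipal_ker_lagCocycle : ArrowGroupoid.IsPrincipal T.lagCocycle.ker.carrier := by
  refine ArrowGroupoid.Cocycle.isPrincipal_ker_iff.2 fun γ hiso hlag => ?_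
  have hγ : γ = Germ.unit γ.srcPath :=
    Germ.ext' (Germ.srcPath_unit _).symm ((Germ.unit_inj hiso).trans (Germ.rngPath_unit _).symm)
      (Eq.trans hlag (Germ.lagFun_unit _).symm)
  rw [hγ]
  exact Germ.unit_mem_units _

theorem Germ.exists_eq_mk_ofPair {γ : T.Germ} (h : T.lagCocycle γ = 1) :
    ∃ (α β : T.FinPath) (h : α.src = β.src) (ξ : T.InfPath) (hξ : β.src = ξ.rng),
      α.length = β.length ∧ γ = mk ⟨Triple.ofPair α β h, ξ, hξ⟩ := by
  induction γ using Quotient.ind with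
  | _ p =>
    obtain ⟨hl, N, hN⟩ := p.lag_eq_one_iff.1 h
    have hg : (p.x.extend (p.ξ.initial N) p.src_eq).g = 1 := hN N le_rfl
    have hs : (p.x.extend (p.ξ.initial N) p.src_eq).α.src =
        (p.x.extend (p.ξ.initial N) p.src_eq).β.src := by rw [Triple.src_eq, hg, one_smul]
    have hx : p.x.extend (p.ξ.initial N) p.src_eq = Triple.ofPair _ _ hs := Triple.ext rfl hg rfl
    refine ⟨_, _, hs, _, (p.x.src_extend _ p.src_eq).trans (p.ξ.src_initial N), ?_,
      (mk_extend_initial p N).symm.trans ?_⟩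
    · rw [extend_initial_α, extend_initial_β, InfPath.length_initial, InfPath.length_initial, hl]
    · congr 1
      exact PreGerm.ext hx rfl

variable (T) in
theorem setOf_lagCocycle_eq_one : {γ : T.Germ | T.lagCocycle γ = 1} =
    {γ | ∃ (α β : T.FinPath) (h : α.src = β.src) (ξ : T.InfPath) (hξ : β.src = ξ.rng),
      α.length = β.length ∧ γ = Germ.mk ⟨Triple.ofPair α β h, ξ, hξ⟩} := by
  refine Set.Subset.antisymm (fun γ => Germ.exists_eq_mk_ofPair) ?_
  rintro _ ⟨α, β, h, ξ, hξ, hl, rfl⟩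
  exact (PreGerm.lag_eq_one_iff _).2 ⟨hl, 0, fun n _ => T.cocList_one _⟩

end

end GraphTriple

theorem corollary6p8_general {G V E : Type*} [Group G] [MulAction G V] [MulAction G E]
    (T : GraphTriple G V E) (hr : ∀ v, (T.r ⁻¹' {v}).Finite) (hT2 : T2Space T.Germ) :
    {γ : T.Germ | T.lagCocycle γ = 1} =
      {γ | ∃ (α β : T.FinPath) (h : α.src = β.src) (ξ : T.InfPath) (hξ : β.src = ξ.rng),
        α.length = β.length ∧ γ = GraphTriple.Germ.mk ⟨GraphTriple.Triple.ofPair α β h, ξ, hξ⟩} ∧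
    ArrowGroupoid.IsPrincipal T.lagCocycle.ker.carrier ∧
    ArrowGroupoid.IsAmple T.Germ ∧
    ArrowGroupoid.IsStronglyEffective T.lagCocycle.ker.carrier ∧
    (IsLocallyConstant T.lagCocycle → ∀ (K : Type*) [Field K],
      ArrowGroupoid.IsGrading K (ArrowGroupoid.homogeneous K T.lagCocycle) ∧
      ∃ Ψ : {U : Set (ArrowGroupoid.units T.Germ) // IsOpen U ∧ ArrowGroupoid.IsInvariant U} ≃o
          {J : Submodule K (T.Germ → K) //
            ArrowGroupoid.IsGradedIdeal (ArrowGroupoid.homogeneous K T.lagCocycle) J},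
        ∀ U, (Ψ U : Submodule K (T.Germ → K)) =
          ArrowGroupoid.steinbergOn K T.Germ (ArrowGroupoid.restrict U.1 U.2.2).carrier) := by
  have hA := GraphTriple.Germ.isAmple hr hT2
  have hp := GraphTriple.isPrincipal_ker_lagCocycle T
  have ho : IsOpen (ArrowGroupoid.units T.lagCocycle.ker.carrier) := by
    rw [ArrowGroupoid.units_sub]
    exact hA.isOpen_units.preimage continuous_subtype_val
  exact ⟨GraphTriple.setOf_lagCocycle_eq_one T, hp, hA, hp.isStronglyEffective ho, fun hc K _ =>
    ⟨ArrowGroupoid.isGrading_homogeneous hA hc,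
      ArrowGroupoid.exists_orderIso_gradedIdeals hA hc hp⟩⟩

theorem corollary6p8 {G V E : Type*} [Group G] [Finite V] [Finite E] [MulAction G V]
    [MulAction G E] (T : GraphTriple G V E) (hT2 : T2Space T.Germ) :
    -- the kernel of the lag function
    {γ : T.Germ | T.lagCocycle γ = 1} =
      {γ | ∃ (α β : T.FinPath) (h : α.src = β.src) (ξ : T.InfPath) (hξ : β.src = ξ.rng),
        α.length = β.length ∧ γ = GraphTriple.Germ.mk ⟨GraphTriple.Triple.ofPair α β h, ξ, hξ⟩} ∧
    ArrowGroupoid.IsPrincipal T.lagCocycle.ker.carrier ∧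
    -- the lag function satisfies the condition on the kernel in the theorem on graded ideals
    ArrowGroupoid.IsAmple T.Germ ∧
    ArrowGroupoid.IsStronglyEffective T.lagCocycle.ker.carrier ∧
    -- the conclusion of that theorem, for which the cocycle has to be locally constant:
    -- `A_K(𝒢)` is graded by the lag group, and `U ↦ A_K(𝒢|_U)` is an isomorphism from the
    -- lattice of open invariant sets of units onto the lattice of graded ideals
    (IsLocallyConstant T.lagCocycle → ∀ (K : Type*) [Field K],
      ArrowGroupoid.IsGrading K (ArrowGroupoid.homogeneous K T.lagCocycle) ∧
      ∃ Ψ : {U : Set (ArrowGroupoid.units T.Germ) // IsOpen U ∧ ArrowGroupoid.IsInvariant U} ≃o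
          {J : Submodule K (T.Germ → K) //
            ArrowGroupoid.IsGradedIdeal (ArrowGroupoid.homogeneous K T.lagCocycle) J},
        ∀ U, (Ψ U : Submodule K (T.Germ → K)) =
          ArrowGroupoid.steinbergOn K T.Germ (ArrowGroupoid.restrict U.1 U.2.2).carrier) := by
  exact corollary6p8_general T (fun _ => Set.toFinite _) hT2
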